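/- **Setting.** Let $\Omega\subset\mathbb R^3$ be a bounded, simply connected domain whose boundary $\Gamma=\partial\Omega$ has finite surface measure $\varsigma$ (the two-dimensional Hausdorff measure on $\Gamma$), with outward unit normal $n$ on $\Gamma$, defined at the points where $\Omega$ has a tangent half-space (almost everywhere if $\Gamma$ is Lipschitz) and set to $0$ elsewhere. Put $X=L^2(\Omega;\mathbb R^3)$ and $H(\operatorname{curl};\Omega)=\{V\in X:\operatorname{curl}V\in X\}$ (distributional curl). For $V\in H(\operatorname{curl};\Omega)$, $V\times n=0$ means $\int_\Omega \operatorname{curl}V\cdot P\,dx=\int_\Omega V\cdot\operatorname{curl}P\,dx$ for all $P\in H(\operatorname{curl};\Omega)$. Let $$\mathcal H=\{v\in H^1_0(\Omega):\ \Delta v\in L^2(\Omega),\ \partial_n v\in L^2(\Gamma)\},\qquad \|v\|_{\mathcal H}^2=\|v\|_{H^1(\Omega)}^2+\|\Delta v\|_{L^2(\Omega)}^2+\|\partial_nv\|_{L^2(\Gamma)}^2,$$ where $\Delta v$ is the distributional Laplacian and $\partial_n v$ is defined by Green's formula $\int_\Omega(\nabla v\cdot\nabla\psi+\psi\,\Delta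 v)\,dx=\int_\Gamma \psi\,\partial_n v\,d\varsigma$ for all $\psi\in C_c^\infty(\mathbb R^3)$. Assume that there is $C>0$ such that for every $g\in L^2(\Omega)$ there is a unique $w\in\mathcal H$ with $\int_\Omega\nabla w\cdot\nabla v\,dx=\int_\Omega g\,v\,dx$ for all $v\in H^1_0(\Omega)$, and $\|w\|_{\mathcal H}\le C\|g\|_{L^2(\Omega)}$. Let $T,q,m,c>0$, $r_0,p_0\in\mathbb R^3$, $E_0,B_0\in X$, and let $\varphi\in C^{2,1}(\mathbb R^3)$ be nonnegative and rotationally symmetric, with $\int_{\mathbb R^3}\varphi\,dx=1$ and support in a ball $\{|x|\le R\}$, $R>0$. For $p\in\mathbb R^3$ set $v(p)=\dfrac{p}{m\sqrt{1+|p|^2/(mc)^2}}$ and $\beta(p)=c^{-1}v(p)$. Let $\mathcal A(V_1,V_2)=(-\operatorname{curl}V_2,\operatorname{curl}V_1)$ be the Maxwell operator on $X\times X$ with domain $\{(V_1,V_2)\in H(\operatorname{curl};\Omega)^2: V_1\times n=0\}$, and let $(\mathcal G(t))_{t\ge0}$ be the $C_0$-semigroup on $X\times X$ generated by $-\mathcal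 A$. Given $u\in L^2(\Gamma)$, a pair $y=(w,z)\in C^1_{\{0\}}([0,T];\mathbb R^3)^2$ (continuously differentiable on $[0,T]$ and vanishing at $t=0$) is a solution of the *reduced state system* if, with $r=w+r_0$ and $p=z+p_0$, for all $t\in[0,T]$, $$\dot w(t)=v(p(t)),$$ $$\dot z(t)=q\int_\Omega\varphi(x-r(t))\big[E(x,t)+\beta(p(t))\times B(x,t)\big]dx-q\int_\Omega\eta(x)\,\nabla\varphi(x-r(t))\times\beta(p(t))\,dx+q\int_\Gamma u(x)\,\varphi(x-r(t))\,\beta(p(t))\times n(x)\,d\varsigma(x),$$ where $(E,B)\in C([0,T];X)^2$ is the mild solution of Maxwell's equations $$\binom{E(t)}{B(t)}=\mathcal G(t)\binom{E_0}{B_0}+\int_0^t\mathcal G(t-\tau)\binom{-q\,\varphi(\cdot-r(\tau))\,v(p(\tau))}{0}\,d\tau,$$ and $\eta\in L^2(\Omega)$ is the very weak solution of $-\Delta\eta=0$ in $\Omega$, $\eta=u$ on $\Gamma$, that is, $-\int_\Omega\eta\,\Delta v\,dx+\int_\Gamma u\,\partial_nv\,d\varsigma=0$ for all $v\in\mathcal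 H$. **Theorem.** There are constants $C_1,C_2>0$ such that for every $u\in L^2(\Gamma)$ the reduced state system has exactly one solution $y=(w,z)\in C^1_{\{0\}}([0,T];\mathbb R^3)^2$, and it satisfies $$\|y\|_{C^1([0,T];\mathbb R^3)^2}\le C_1\|u\|_{L^2(\Gamma)}+C_2 .$$ (That $\mathcal G$ and $\eta$ exist is part of the assertion.) -/

import Mathlib

open MeasureTheory Set Filter Topology
open scoped ContDiff

noncomputable section

namespace Abraham

/-! ### Euclidean space, vector calculus, surface measure and normal -/

/-- `ℝ³` with the Euclidean norm. -/
abbrev R3 : Type := EuclideanSpace ℝ (Fin 3)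

/-- The cross product on Euclidean `ℝ³`. -/
def cross (a b : R3) : R3 := WithLp.toLp 2 (crossProduct a.ofLp b.ofLp)

/-- The classical partial derivative `∂ᵢ ψⱼ (x)` of a vector field. -/
def partialD (ψ : R3 → R3) (i j : Fin 3) (x : R3) : ℝ :=
  fderiv ℝ ψ x (EuclideanSpace.single i 1) j

/-- The classical curl of a vector field. -/
def curl (ψ : R3 → R3) (x : R3) : R3 :=
  !₂[partialD ψ 1 2 x - partialD ψ 2 1 x,
     partialD ψ 2 0 x - partialD ψ 0 2 x,
     partialD ψ 0 1 x - partialD ψ 1 0 x]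

/-- Test functions on `Ω`: smooth, with compact support contained in `Ω`. -/
def IsTest {F : Type} [NormedAddCommGroup F] [NormedSpace ℝ F] (Ω : Set R3) (ψ : R3 → F) : Prop :=
  ContDiff ℝ ∞ ψ ∧ HasCompactSupport ψ ∧ tsupport ψ ⊆ Ω

/-- Lebesgue measure on `Ω`. -/
abbrev vol (Ω : Set R3) : Measure R3 := volume.restrict Ω

/-- The surface measure on `Γ = ∂Ω`: two-dimensional Hausdorff measure, normalized so that it is
the usual area on planes. -/
def surf (Ω : Set R3) : Measure R3 := (Measure.euclideanHausdorffMeasure 2).restrict (frontier Ω)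

/-- `ν` is the outward unit normal to `Ω` at `x`: seen from `x`, the set `Ω` is asymptotically the
half-space `{y | ⟪y - x, ν⟫ < 0}`. Such a `ν` is unique if it exists; on Lipschitz domains it exists
almost everywhere on the boundary. -/
def IsOutwardUnitNormal (Ω : Set R3) (x ν : R3) : Prop :=
  ‖ν‖ = 1 ∧ ∀ ε > 0, ∃ δ > 0, ∀ y : R3, dist y x < δ →
    (inner ℝ (y - x) ν < -ε * ‖y - x‖ → y ∈ Ω) ∧ (ε * ‖y - x‖ < inner ℝ (y - x) ν → y ∉ Ω)

open Classical in
/-- The outward unit normal field `n` (with value `0` at points where there is no normal). -/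
def outwardNormal (Ω : Set R3) (x : R3) : R3 :=
  if h : ∃ ν, IsOutwardUnitNormal Ω x ν then h.choose else 0

/-! ### Function spaces -/

/-- `L²(Ω)`. -/
abbrev L2 (Ω : Set R3) : Type := Lp ℝ 2 (vol Ω)

/-- `X = L²(Ω; ℝ³)`. -/
abbrev X (Ω : Set R3) : Type := Lp R3 2 (vol Ω)

/-- `X × X` with its Hilbert space structure. -/
abbrev XX (Ω : Set R3) : Type := WithLp 2 (X Ω × X Ω)

/-- `L²(Γ)`. -/
abbrev L2Γ (Ω : Set R3) : Type := Lp ℝ 2 (surf Ω)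

/-- `V ∈ H(curl; Ω)` with distributional curl `W ∈ X`. -/
def HasWeakCurl (Ω : Set R3) (V W : X Ω) : Prop :=
  ∀ ψ : R3 → R3, IsTest Ω ψ →
    ∫ x, inner ℝ (V x) (curl ψ x) ∂(vol Ω) = ∫ x, inner ℝ (W x) (ψ x) ∂(vol Ω)

/-- `V ∈ H(curl; Ω)` with curl `W`, and the tangential trace `V × n` vanishes, that is, the boundary
term in Green's formula for the curl vanishes against every field in `H(curl; Ω)`. -/
def HasWeakCurlZeroTrace (Ω : Set R3) (V W : X Ω) : Prop :=
  HasWeakCurl Ω V W ∧ ∀ P Q : X Ω, HasWeakCurl Ω P Q → inner ℝ W P = inner ℝ V Q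

/-- `F ∈ H(div; Ω)` with distributional divergence `d ∈ L²(Ω)`. -/
def HasWeakDiv (Ω : Set R3) (F : X Ω) (d : L2 Ω) : Prop :=
  ∀ ψ : R3 → ℝ, IsTest Ω ψ →
    ∫ x, inner ℝ (F x) (gradient ψ x) ∂(vol Ω) = - ∫ x, d x * ψ x ∂(vol Ω)

/-- The normal trace `F · n` of a field `F` with divergence `d` is the function `g ∈ L²(Γ)`, in the
sense of Green's formula. -/
def HasNormalTrace (Ω : Set R3) (F : X Ω) (d : L2 Ω) (g : L2Γ Ω) : Prop :=
  ∀ ψ : R3 → ℝ, ContDiff ℝ ∞ ψ → HasCompactSupport ψ →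
    ∫ x, inner ℝ (F x) (gradient ψ x) ∂(vol Ω) + ∫ x, d x * ψ x ∂(vol Ω) =
      ∫ x, g x * ψ x ∂(surf Ω)

/-- `v ∈ H¹₀(Ω)` with weak gradient `G`: the pair `(v, G)` is a limit in `L²(Ω) × L²(Ω; ℝ³)` of pairs
`(ψ, ∇ψ)` with test functions `ψ` on `Ω`. -/
def IsH10 (Ω : Set R3) (v : L2 Ω) (G : X Ω) : Prop :=
  (v, G) ∈ closure {P : L2 Ω × X Ω | ∃ ψ : R3 → ℝ, IsTest Ω ψ ∧
    P.1 =ᵐ[vol Ω] ψ ∧ P.2 =ᵐ[vol Ω] gradient ψ}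

/-- The space `𝓗` of all `v ∈ H¹₀(Ω)` with `∇v ∈ H(div; Ω)` and `∂ₙv ∈ L²(Γ)`. An element is recorded
together with `∇v`, `Δv` and `∂ₙv`, which are determined by `v`. -/
structure HSpace (Ω : Set R3) where
  /-- the function `v` -/
  val : L2 Ω
  /-- the gradient `∇v` -/
  grad : X Ω
  /-- the Laplacian `Δv` -/
  lap : L2 Ω
  /-- the normal derivative `∂ₙv` -/
  normalDeriv : L2Γ Ω
  isH10 : IsH10 Ω val grad
  hasWeakDiv : HasWeakDiv Ω grad lap
  hasNormalTrace : HasNormalTrace Ω grad lap normalDeriv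

/-- The norm of `𝓗`. -/
def HSpace.hnorm {Ω : Set R3} (v : HSpace Ω) : ℝ :=
  Real.sqrt (‖v.val‖ ^ 2 + ‖v.grad‖ ^ 2 + ‖v.lap‖ ^ 2 + ‖v.normalDeriv‖ ^ 2)

/-- `w ∈ 𝓗` solves `-Δw = g`, `w = 0` on `Γ`, in the weak sense. -/
def IsWeakPoisson (Ω : Set R3) (g : L2 Ω) (w : HSpace Ω) : Prop :=
  ∀ (v : L2 Ω) (G : X Ω), IsH10 Ω v G →
    ∫ x, inner ℝ (w.grad x) (G x) ∂(vol Ω) = ∫ x, g x * v x ∂(vol Ω)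

/-- The regularity assumption on the domain: for every `g ∈ L²(Ω)` the homogeneous Dirichlet problem
has a unique weak solution in `𝓗`, with `‖w‖_𝓗 ≤ C ‖g‖`. -/
def PoissonRegular (Ω : Set R3) : Prop :=
  ∃ C > 0, ∀ g : L2 Ω, (∃! w : HSpace Ω, IsWeakPoisson Ω g w) ∧
    ∀ w : HSpace Ω, IsWeakPoisson Ω g w → w.hnorm ≤ C * ‖g‖

/-- `η ∈ L²(Ω)` is the very weak solution of `-Δη = 0` in `Ω`, `η = u` on `Γ`. -/
def IsVeryWeakSolution (Ω : Set R3) (u : L2Γ Ω) (η : L2 Ω) : Prop :=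
  ∀ v : HSpace Ω,
    -(∫ x, η x * v.lap x ∂(vol Ω)) + ∫ x, u x * v.normalDeriv x ∂(surf Ω) = 0

/-! ### Maxwell's equations -/

/-- The graph of the Maxwell operator: `V` lies in the domain of `𝒜` and `𝒜 V = W`, where
`𝒜 (V₁, V₂) = (-curl V₂, curl V₁)` for `V₁, V₂ ∈ H(curl; Ω)` with `V₁ × n = 0`. -/
def IsMaxwellOp (Ω : Set R3) (V W : XX Ω) : Prop :=
  HasWeakCurlZeroTrace Ω V.fst W.snd ∧ HasWeakCurl Ω V.snd (-W.fst)

/-- `G` is a `C₀`-semigroup on `H` (only the values at `t ≥ 0` matter). -/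
structure IsC0Semigroup {H : Type} [NormedAddCommGroup H] [NormedSpace ℝ H]
    (G : ℝ → H →L[ℝ] H) : Prop where
  zero : G 0 = ContinuousLinearMap.id ℝ H
  add : ∀ s t : ℝ, 0 ≤ s → 0 ≤ t → G (s + t) = (G s).comp (G t)
  tendsto : ∀ V : H, Tendsto (fun t => G t V) (𝓝[>] 0) (𝓝 V)

/-- `V` lies in the domain of the infinitesimal generator of `G`, which maps it to `W`. -/
def IsGenerator {H : Type} [NormedAddCommGroup H] [NormedSpace ℝ H]
    (G : ℝ → H →L[ℝ] H) (V W : H) : Prop :=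
  Tendsto (fun h : ℝ => h⁻¹ • (G h V - V)) (𝓝[>] 0) (𝓝 W)

/-- `G` is the `C₀`-semigroup of the homogeneous Maxwell system `∂ₜ V + 𝒜 V = 0`, that is, the
`C₀`-semigroup whose infinitesimal generator is `-𝒜`, with equality of domains. -/
def IsMaxwellSemigroup (Ω : Set R3) (G : ℝ → XX Ω →L[ℝ] XX Ω) : Prop :=
  IsC0Semigroup G ∧ ∀ V W : XX Ω, IsGenerator G V W ↔ IsMaxwellOp Ω V (-W)

/-- `V = (E, B) ∈ C([0,T]; X)²` is the mild solution of `∂ₜ V + 𝒜 V = j`, `V(0) = V₀`. -/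
def IsMildSolution (Ω : Set R3) (T : ℝ) (V₀ : XX Ω) (j V : ℝ → XX Ω) : Prop :=
  ContinuousOn V (Icc 0 T) ∧ ∃ G : ℝ → XX Ω →L[ℝ] XX Ω, IsMaxwellSemigroup Ω G ∧
    ∀ t ∈ Icc 0 T, V t = G t V₀ + ∫ τ in (0 : ℝ)..t, G (t - τ) (j τ)

/-! ### The particle -/

/-- The Lorentz factor `γ(p)`, with rest mass `m` and speed of light `c`. -/
def lorentzFactor (m c : ℝ) (p : R3) : ℝ := Real.sqrt (1 + ‖p‖ ^ 2 / (m * c) ^ 2)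

/-- The velocity `v(p) = p / (m γ(p))`. -/
def velocity (m c : ℝ) (p : R3) : R3 := (m * lorentzFactor m c p)⁻¹ • p

/-- `β(p) = v(p) / c`. -/
def beta (m c : ℝ) (p : R3) : R3 := c⁻¹ • velocity m c p

/-- A smeared out delta distribution: a nonnegative, rotationally symmetric function of class
`C^{2,1}` with integral one, supported in a ball of radius `R` around the origin. -/
structure SmearedDelta where
  /-- the function itself -/
  φ : R3 → ℝ
  /-- the radius of the ball -/
  R : ℝ
  R_pos : 0 < R
  contDiff : ContDiff ℝ 2 φ
  lipschitz : ∃ K, LipschitzWith K (iteratedFDeriv ℝ 2 φ)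
  support : tsupport φ ⊆ Metric.closedBall 0 R
  nonneg : ∀ x, 0 ≤ φ x
  integral : ∫ x, φ x = 1
  radial : ∀ x y : R3, ‖x‖ = ‖y‖ → φ x = φ y

theorem SmearedDelta.hasCompactSupport (D : SmearedDelta) : HasCompactSupport D.φ :=
  (isCompact_closedBall (0 : R3) D.R).of_isClosed_subset (isClosed_tsupport _) D.support

theorem SmearedDelta.memLp (D : SmearedDelta) (Ω : Set R3) (a : ℝ) (r b : R3) :
    MemLp (fun x => (a * D.φ (x - r)) • b) 2 (vol Ω) := by
  have hc : Continuous (fun x => D.φ (x - r)) :=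
    D.contDiff.continuous.comp (continuous_id.sub continuous_const)
  have hs : HasCompactSupport (fun x => D.φ (x - r)) := by
    have h := D.hasCompactSupport.comp_homeomorph (Homeomorph.subRight r)
    exact h
  have h1 : Continuous (fun x => (a * D.φ (x - r)) • b) :=
    (continuous_const.mul hc).smul continuous_const
  refine (h1.memLp_of_hasCompactSupport (μ := volume) ?_).restrict Ω
  exact (hs.mul_left (f := fun _ => a)).smul_right (f' := fun _ => b)

/-- The current density `j(r,p) = (-q φ(· - r) v(p), 0) ∈ X × X` for position `r` and momentum `p`. -/
def current (Ω : Set R3) (D : SmearedDelta) (q m c : ℝ) (r p : R3) : XX Ω :=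
  WithLp.toLp 2 ((D.memLp Ω (-q) r (velocity m c p)).toLp, 0)

/-- The force on the particle with position `r` and momentum `p`: the smeared Lorentz force of the
fields `V = (E, B)`, the contribution of the potential `η` and that of its boundary values `u`. -/
def force (Ω : Set R3) (D : SmearedDelta) (q m c : ℝ) (u : L2Γ Ω) (η : L2 Ω) (V : XX Ω)
    (r p : R3) : R3 :=
  q • (∫ x, D.φ (x - r) • (V.fst x + cross (beta m c p) (V.snd x)) ∂(vol Ω))
    - q • (∫ x, η x • cross (gradient D.φ (x - r)) (beta m c p) ∂(vol Ω))
    + q • (∫ x, (u x * D.φ (x - r)) • cross (beta m c p) (outwardNormal Ω x) ∂(surf Ω))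

/-- `w ∈ C¹_{0}([0,T]; ℝ³)`: continuously differentiable on `[0,T]` and vanishing at `0`. Only the
values on `[0,T]` matter. -/
def IsC1Zero (T : ℝ) (w : ℝ → R3) : Prop := ContDiffOn ℝ 1 w (Icc 0 T) ∧ w 0 = 0

/-- The norm of `y = (w, z)` in `C¹([0,T]; ℝ³)²`, with the Euclidean norm on `ℝ³ × ℝ³`. -/
def c1Norm (T : ℝ) (w z : ℝ → R3) : ℝ :=
  (⨆ t : Icc (0 : ℝ) T, ‖(WithLp.toLp 2 (w t, z t) : WithLp 2 (R3 × R3))‖) +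
  ⨆ t : Icc (0 : ℝ) T, ‖(WithLp.toLp 2 (derivWithin w (Icc 0 T) t, derivWithin z (Icc 0 T) t) :
    WithLp 2 (R3 × R3))‖

/-- `y = (w, z) ∈ C¹_{0}([0,T]; ℝ³)²` solves the reduced state system with control `u`: with
`r = w + r₀`, `p = z + p₀`, the Newton–Lorentz equations hold on `[0,T]`, where `V = (E, B)` is the
mild solution of Maxwell's equations with current `j(r,p)` and `η` is the very weak solution of the
Poisson equation with boundary data `u`. -/
def IsReducedSolution (Ω : Set R3) (T : ℝ) (D : SmearedDelta) (q m c : ℝ) (r₀ p₀ : R3)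
    (E₀ B₀ : X Ω) (u : L2Γ Ω) (w z : ℝ → R3) : Prop :=
  IsC1Zero T w ∧ IsC1Zero T z ∧
  ∃ (V : ℝ → XX Ω) (η : L2 Ω),
    IsMildSolution Ω T (WithLp.toLp 2 (E₀, B₀))
      (fun t => current Ω D q m c (w t + r₀) (z t + p₀)) V ∧
    IsVeryWeakSolution Ω u η ∧
    ∀ t ∈ Icc 0 T,
      derivWithin z (Icc 0 T) t = force Ω D q m c u η (V t) (w t + r₀) (z t + p₀) ∧
      derivWithin w (Icc 0 T) t = velocity m c (z t + p₀)

end Abraham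

end

/-! The curl on test fields and its adjoints make the Maxwell operator a skew block operator, which
von Neumann's graph argument shows to be m-accretive; the Yosida approximations then yield a
contraction semigroup, and a `C₀`-semigroup is determined by its generator. The very weak solution
operator `u ↦ η` is, up to sign, the adjoint of the map that takes `g` to the normal derivative of
the solution of the Poisson problem, hence bounded.

Once the fields are eliminated by Duhamel's formula, the reduced state system is an evolution
equation `y' = Φ y` with memory. The semigroup is contractive, and the smeared charge, the velocity
and the force are bounded and Lipschitz continuous in the state, so `Φ y` at time `t` depends
Lipschitz continuously on `y` restricted to `[0, t]`, and an iterate of the Picard operator is a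
contraction. As relativistic velocities are bounded, `Φ` itself is bounded, linearly in `u`, which
gives the a priori estimate. -/

noncomputable section

namespace Abraham

/-! ### Semigroups generated by m-accretive operators -/

section C0Semigroup

variable {H : Type} [NormedAddCommGroup H] [NormedSpace ℝ H]

theorem tendsto_clm_apply {ι : Type*} {l : Filter ι} {F : ι → H →L[ℝ] H} {u : ι → H} {x y : H}
    {M : ℝ} (hM : ∀ᶠ i in l, ‖F i‖ ≤ M) (hF : Tendsto (fun i => F i x) l (𝓝 y))
    (hu : Tendsto u l (𝓝 x)) : Tendsto (fun i => F i (u i)) l (𝓝 y) := by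
  have hdiff : Tendsto (fun i => F i (u i - x)) l (𝓝 0) := by
    refine squeeze_zero_norm' (hM.mono fun i hi => (F i).le_of_opNorm_le hi _) ?_
    simpa using (tendsto_iff_norm_sub_tendsto_zero.1 hu).const_mul M
  simpa using hdiff.add hF

theorem tendsto_clm_of_dense {ι : Type*} {l : Filter ι} {S : Set H} (hS : Dense S) {M : ℝ}
    {F : ι → H →L[ℝ] H} (hF : ∀ i, ‖F i‖ ≤ M) (F' : H →L[ℝ] H)
    (h : ∀ x ∈ S, Tendsto (fun i => F i x) l (𝓝 (F' x))) (x : H) :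
    Tendsto (fun i => F i x) l (𝓝 (F' x)) := by
  have hequi : Equicontinuous ((↑) ∘ F) :=
    ((NormedSpace.equicontinuous_TFAE F).out 5 1).1 (by simpa using ⟨M, hF⟩)
  exact (hequi x).tendsto_of_mem_closure (F'.continuous.tendsto x |>.mono_left nhdsWithin_le_nhds)
    h (hS x)

namespace IsC0Semigroup

variable {G S : ℝ → H →L[ℝ] H} {V W : H}

theorem add_apply (hG : IsC0Semigroup G) {s t : ℝ} (hs : 0 ≤ s) (ht : 0 ≤ t) (V : H) :
    G (s + t) V = G s (G t V) :=
  DFunLike.congr_fun (hG.add s t hs ht) V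

theorem tendsto_nhdsGE_zero (hG : IsC0Semigroup G) (V : H) :
    Tendsto (fun t => G t V) (𝓝[≥] 0) (𝓝 V) := by
  rw [← Ioi_insert, nhdsWithin_insert, tendsto_sup, tendsto_pure_left]
  refine ⟨fun s hs => ?_, hG.tendsto V⟩
  simpa [hG.zero] using mem_of_mem_nhds hs

theorem exists_norm_le_near_zero [CompleteSpace H] (hG : IsC0Semigroup G) :
    ∃ δ > 0, ∃ M, ∀ t ∈ Icc 0 δ, ‖G t‖ ≤ M := by
  by_contra! hcon
  choose t ht hM using fun n : ℕ => hcon (1 / (n + 1 : ℝ)) (by positivity) n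
  have ht0 : Tendsto t atTop (𝓝[≥] 0) :=
    tendsto_nhdsWithin_iff.2 ⟨squeeze_zero (fun n => (ht n).1) (fun n => (ht n).2)
      tendsto_one_div_add_atTop_nhds_zero_nat, Eventually.of_forall fun n => (ht n).1⟩
  have hptwise (V : H) : ∃ C, ∀ n, ‖G (t n) V‖ ≤ C := by
    obtain ⟨C, hC⟩ := ((hG.tendsto_nhdsGE_zero V).comp ht0).norm.bddAbove_range
    exact ⟨C, fun n => hC ⟨n, rfl⟩⟩
  obtain ⟨C, hC⟩ := banach_steinhaus hptwise
  obtain ⟨n, hn⟩ := exists_nat_gt C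
  exact (hn.trans (hM n)).not_ge (hC n)

theorem exists_norm_le [CompleteSpace H] (hG : IsC0Semigroup G) (b : ℝ) :
    ∃ M, ∀ t ∈ Icc 0 b, ‖G t‖ ≤ M := by
  obtain ⟨δ, hδ, M, hM⟩ := hG.exists_norm_le_near_zero
  have hmul (n : ℕ) : ∃ N, ∀ t ∈ Icc 0 (n * δ), ‖G t‖ ≤ N := by
    induction n with
    | zero => exact ⟨M, fun t ht => hM t ⟨ht.1, ht.2.trans (by simpa using hδ.le)⟩⟩
    | succ n ih =>
      obtain ⟨N, hN⟩ := ih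
      refine ⟨max M (M * N), fun t ht => ?_⟩
      rcases le_total t δ with h | h
      · exact (hM t ⟨ht.1, h⟩).trans (le_max_left _ _)
      · have hmem : t - δ ∈ Icc 0 (n * δ) := by
          have := ht.2
          push_cast at this
          exact ⟨by linarith, by linarith⟩
        rw [← add_sub_cancel δ t, hG.add _ _ hδ.le hmem.1]
        refine ((ContinuousLinearMap.opNorm_comp_le _ _).trans ?_).trans (le_max_right _ _)
        gcongr
        exacts [(norm_nonneg _).trans (hM δ ⟨hδ.le, le_rfl⟩), hM δ ⟨hδ.le, le_rfl⟩, hN _ hmem]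
  obtain ⟨n, hn⟩ := exists_nat_gt (b / δ)
  obtain ⟨N, hN⟩ := hmul n
  exact ⟨N, fun t ht => hN t ⟨ht.1, ht.2.trans ((div_lt_iff₀ hδ).1 hn).le⟩⟩

theorem norm_sub_le (hG : IsC0Semigroup G) {M s t : ℝ} (hs : 0 ≤ s) (ht : 0 ≤ t)
    (hMs : ‖G s‖ ≤ M) (hMt : ‖G t‖ ≤ M) (V : H) :
    ‖G t V - G s V‖ ≤ M * ‖G |t - s| V - V‖ := by
  wlog hst : s ≤ t generalizing s t
  · rw [norm_sub_rev, abs_sub_comm]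
    exact this ht hs hMt hMs (le_of_not_ge hst)
  have hsub : G t V = G s (G (t - s) V) := by
    rw [← hG.add_apply hs (sub_nonneg.2 hst), add_sub_cancel]
  rw [hsub, ← map_sub, abs_of_nonneg (sub_nonneg.2 hst)]
  exact (G s).le_of_opNorm_le hMs _

theorem continuousOn [CompleteSpace H] (hG : IsC0Semigroup G) (V : H) :
    ContinuousOn (fun t => G t V) (Ici 0) := by
  intro s hs
  obtain ⟨M, hM⟩ := hG.exists_norm_le (s + 1)
  rw [ContinuousWithinAt, tendsto_iff_norm_sub_tendsto_zero]
  have hlim : Tendsto (fun t => M * ‖G |t - s| V - V‖) (𝓝[Ici 0] s) (𝓝 0) := by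
    have hshift : Tendsto (fun t => |t - s|) (𝓝[Ici 0] s) (𝓝[≥] 0) := by
      refine tendsto_nhdsWithin_iff.2 ⟨?_, Eventually.of_forall fun t => mem_Ici.2 (abs_nonneg _)⟩
      have hcont : Continuous fun t => |t - s| := by fun_prop
      simpa using (hcont.tendsto s).mono_left nhdsWithin_le_nhds
    simpa using
      (tendsto_iff_norm_sub_tendsto_zero.1 ((hG.tendsto_nhdsGE_zero V).comp hshift)).const_mul M
  refine squeeze_zero' (Eventually.of_forall fun _ => norm_nonneg _) ?_ hlim
  filter_upwards [self_mem_nhdsWithin, nhdsWithin_le_nhds (Iic_mem_nhds (lt_add_one s))]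
    with t ht hts
  exact hG.norm_sub_le hs ht (hM s ⟨hs, by linarith⟩) (hM t ⟨ht, hts⟩) V

theorem isGenerator_apply (hG : IsC0Semigroup G) (h : IsGenerator G V W) {t : ℝ} (ht : 0 ≤ t) :
    IsGenerator G (G t V) (G t W) := by
  refine (((G t).continuous.tendsto W).comp h).congr' ?_
  filter_upwards [self_mem_nhdsWithin] with s hs
  have hcomm : G s (G t V) = G t (G s V) := by
    rw [← hG.add_apply (le_of_lt hs) ht, add_comm, hG.add_apply ht (le_of_lt hs)]
  simp [hcomm]

theorem hasDerivWithinAt_sub_apply [CompleteSpace H] (hG : IsC0Semigroup G) (hS : IsC0Semigroup S)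
    {s t : ℝ} (hs : s ∈ Ico 0 t) (hVG : IsGenerator G (G s V) W) (hVS : IsGenerator S (G s V) W) :
    HasDerivWithinAt (fun s => S (t - s) (G s V)) 0 (Ici s) s := by
  obtain ⟨M, hM⟩ := hS.exists_norm_le t
  rw [← hasDerivWithinAt_Ioi_iff_Ici, hasDerivWithinAt_iff_tendsto_slope' (by simp)]
  have hshift : Tendsto (fun r => r - s) (𝓝[>] s) (𝓝[>] 0) := by
    refine tendsto_nhdsWithin_iff.2 ⟨?_, ?_⟩
    · have hcont : Continuous fun r => r - s := by fun_prop
      simpa using (hcont.tendsto s).mono_left nhdsWithin_le_nhds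
    · filter_upwards [self_mem_nhdsWithin] with r hr using mem_Ioi.2 (sub_pos.2 hr)
  have hquot : Tendsto (fun r => (r - s)⁻¹ • (G (r - s) (G s V) - G s V) -
      (r - s)⁻¹ • (S (r - s) (G s V) - G s V)) (𝓝[>] s) (𝓝 0) := by
    simpa using (hVG.comp hshift).sub (hVS.comp hshift)
  have hnear : Ioc s t ∈ 𝓝[>] s := Ioc_mem_nhdsGT hs.2
  refine (tendsto_clm_apply (F := fun r => S (t - r)) (M := M) ?_ (by simp) hquot).congr' ?_
  · filter_upwards [hnear] with r hr
    exact hM _ ⟨by linarith [hr.2], by linarith [hr.1, hs.1]⟩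
  · filter_upwards [hnear] with r hr
    have hr' : 0 ≤ r - s := sub_nonneg.2 hr.1.le
    have hGr : G r V = G (r - s) (G s V) := by rw [← hG.add_apply hr' hs.1, sub_add_cancel]
    have hSr : S (t - s) (G s V) = S (t - r) (S (r - s) (G s V)) := by
      rw [← hS.add_apply (sub_nonneg.2 hr.2) hr', sub_add_sub_cancel]
    rw [slope_def_module, hGr, hSr, ← map_sub, ← map_smul, ← smul_sub, sub_sub_sub_cancel_right]

theorem eq_of_isGenerator [CompleteSpace H] (hG : IsC0Semigroup G) (hS : IsC0Semigroup S)
    (hD : Dense {V | ∃ W, IsGenerator G V W})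
    (hGS : ∀ V W, IsGenerator G V W → IsGenerator S V W) {t : ℝ} (ht : 0 ≤ t) : G t = S t := by
  obtain ⟨M, hM⟩ := hS.exists_norm_le t
  refine ContinuousLinearMap.ext_on (hD.mono Submodule.subset_span) fun V ⟨W, h⟩ => ?_
  have hcont : ContinuousOn (fun s => S (t - s) (G s V)) (Icc 0 t) := by
    intro s hs
    refine tendsto_clm_apply (M := M) ?_ ?_
      ((hG.continuousOn V).mono Icc_subset_Ici_self s hs)
    · filter_upwards [self_mem_nhdsWithin] with r hr
      exact hM _ ⟨by linarith [hr.2], by linarith [hr.1]⟩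
    · exact (((hS.continuousOn (G s V)).comp (continuous_const.sub continuous_id).continuousOn
        fun r hr => sub_nonneg.2 hr.2) s hs)
  have hderiv (s : ℝ) (hs : s ∈ Ico 0 t) :
      HasDerivWithinAt (fun s => S (t - s) (G s V)) 0 (Ici s) s :=
    have hGs := hG.isGenerator_apply h hs.1
    hG.hasDerivWithinAt_sub_apply hS hs hGs (hGS _ _ hGs)
  simpa [hG.zero, hS.zero] using constant_of_has_deriv_right_zero hcont hderiv t ⟨ht, le_rfl⟩

end IsC0Semigroup

end C0Semigroup

section HilleYosida

theorem norm_exp_le_exp_norm {𝔸 : Type*} [NormedRing 𝔸] [NormedAlgebra ℝ 𝔸]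
    (h1 : ‖(1 : 𝔸)‖ ≤ 1) (x : 𝔸) : ‖NormedSpace.exp x‖ ≤ Real.exp ‖x‖ := by
  rw [NormedSpace.exp_eq_tsum ℝ, Real.exp_eq_exp_ℝ]
  refine tsum_of_norm_bounded (NormedSpace.expSeries_div_hasSum_exp ‖x‖) fun n => ?_
  rw [norm_smul, norm_inv, RCLike.norm_natCast, div_eq_inv_mul]
  gcongr
  rcases n.eq_zero_or_pos with rfl | hn
  · simpa using h1
  · exact norm_pow_le' x hn

theorem norm_exp_smul_sub_one_le {𝔸 : Type*} [NormedRing 𝔸] [NormedAlgebra ℝ 𝔸] [CompleteSpace 𝔸]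
    (h1 : ‖(1 : 𝔸)‖ ≤ 1) {J : 𝔸} (hJ : ‖J‖ ≤ 1) {s : ℝ} (hs : 0 ≤ s) :
    ‖NormedSpace.exp (s • (J - 1))‖ ≤ 1 := by
  let _ : NormedAlgebra ℚ 𝔸 := NormedAlgebra.restrictScalars ℚ ℝ 𝔸
  have hfactor : NormedSpace.exp (s • (J - 1)) = Real.exp (-s) • NormedSpace.exp (s • J) := by
    have hsplit : s • (J - 1) = algebraMap ℝ 𝔸 (-s) + s • J := by
      rw [Algebra.algebraMap_eq_smul_one, smul_sub, neg_smul]; abel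
    rw [hsplit, NormedSpace.exp_add_of_commute (Algebra.commutes _ _),
      ← NormedSpace.algebraMap_exp_comm, ← Real.exp_eq_exp_ℝ, ← Algebra.smul_def]
  calc ‖NormedSpace.exp (s • (J - 1))‖
      = Real.exp (-s) * ‖NormedSpace.exp (s • J)‖ := by
        rw [hfactor, norm_smul, Real.norm_of_nonneg (Real.exp_pos _).le]
    _ ≤ Real.exp (-s) * Real.exp s := by
        gcongr
        refine (norm_exp_le_exp_norm h1 _).trans (Real.exp_le_exp.2 ?_)
        rw [norm_smul, Real.norm_of_nonneg hs]
        exact mul_le_of_le_one_right hs hJ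
    _ = 1 := by rw [← Real.exp_add, neg_add_cancel, Real.exp_zero]

variable {H : Type} [NormedAddCommGroup H] [NormedSpace ℝ H] {A : H →ₗ.[ℝ] H}

/-- A densely defined m-accretive operator on a normed space: `1 + ε A` is onto and does not
decrease norms, for every `ε > 0`. -/
structure IsMAccretive (A : H →ₗ.[ℝ] H) : Prop where
  dense : Dense (A.domain : Set H)
  norm_le : ∀ ε : ℝ, 0 < ε → ∀ x : A.domain, ‖(x : H)‖ ≤ ‖(x : H) + ε • A x‖
  surjective : ∀ ε : ℝ, 0 < ε → Function.Surjective fun x : A.domain => (x : H) + ε • A x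

namespace IsMAccretive

/-- The bijection `1 + (n + 1)⁻¹ A` of the domain of `A` with the whole space. -/
def shiftEquiv (hA : IsMAccretive A) (n : ℕ) : A.domain ≃ₗ[ℝ] H :=
  LinearEquiv.ofBijective (A.domain.subtype + (n + 1 : ℝ)⁻¹ • A.toFun)
    ⟨(injective_iff_map_eq_zero _).2 fun x hx => by
      have hle := hA.norm_le (n + 1 : ℝ)⁻¹ (by positivity) x
      rw [show (x : H) + (n + 1 : ℝ)⁻¹ • A x = 0 from hx, norm_zero] at hle
      exact Subtype.ext (norm_le_zero_iff.1 hle),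
    hA.surjective _ (by positivity)⟩

theorem shiftEquiv_apply (hA : IsMAccretive A) (n : ℕ) (x : A.domain) :
    hA.shiftEquiv n x = x + (n + 1 : ℝ)⁻¹ • A x := rfl

/-- The resolvent `(1 + (n + 1)⁻¹ A)⁻¹`. -/
def resolvent (hA : IsMAccretive A) (n : ℕ) : H →L[ℝ] H :=
  (A.domain.subtype ∘ₗ (hA.shiftEquiv n).symm.toLinearMap).mkContinuous 1 fun f => by
    have hle := hA.norm_le (n + 1 : ℝ)⁻¹ (by positivity) ((hA.shiftEquiv n).symm f)
    rw [← hA.shiftEquiv_apply, LinearEquiv.apply_symm_apply] at hle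
    simpa using hle

/-- The Yosida approximation `A (1 + (n + 1)⁻¹ A)⁻¹ = (n + 1) (1 - (1 + (n + 1)⁻¹ A)⁻¹)`. -/
def yosida (hA : IsMAccretive A) (n : ℕ) : H →L[ℝ] H :=
  (n + 1 : ℝ) • (1 - hA.resolvent n)

theorem norm_resolvent_le (hA : IsMAccretive A) (n : ℕ) : ‖hA.resolvent n‖ ≤ 1 :=
  LinearMap.mkContinuous_norm_le _ zero_le_one _

theorem resolvent_shift (hA : IsMAccretive A) (n : ℕ) (x : A.domain) :
    hA.resolvent n (x + (n + 1 : ℝ)⁻¹ • A x) = x :=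
  congrArg Subtype.val ((hA.shiftEquiv n).symm_apply_apply x)

theorem exists_resolvent_eq (hA : IsMAccretive A) (n : ℕ) (f : H) :
    ∃ x : A.domain, hA.resolvent n f = x ∧ f = x + (n + 1 : ℝ)⁻¹ • A x :=
  ⟨(hA.shiftEquiv n).symm f, rfl, ((hA.shiftEquiv n).apply_symm_apply f).symm⟩

theorem yosida_coe (hA : IsMAccretive A) (n : ℕ) (x : A.domain) :
    hA.yosida n x = hA.resolvent n (A x) := by
  have hpos : (n + 1 : ℝ) ≠ 0 := by positivity
  have hx := hA.resolvent_shift n x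
  rw [map_add, map_smul, ← eq_sub_iff_add_eq', inv_smul_eq_iff₀ hpos] at hx
  exact hx.symm

theorem norm_yosida_coe_le (hA : IsMAccretive A) (n : ℕ) (x : A.domain) :
    ‖hA.yosida n x‖ ≤ ‖A x‖ := by
  simpa [hA.yosida_coe] using (hA.resolvent n).le_of_opNorm_le (hA.norm_resolvent_le n) (A x)

theorem exists_yosida_eq (hA : IsMAccretive A) (n : ℕ) (f : H) :
    ∃ x : A.domain, hA.resolvent n f = x ∧ hA.yosida n f = A x := by
  have hpos : (n + 1 : ℝ) ≠ 0 := by positivity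
  obtain ⟨x, hx, hf⟩ := hA.exists_resolvent_eq n f
  refine ⟨x, hx, ?_⟩
  change (n + 1 : ℝ) • (f - hA.resolvent n f) = A x
  rw [hx, hf, add_sub_cancel_left, smul_inv_smul₀ hpos]

theorem commute_resolvent (hA : IsMAccretive A) (n k : ℕ) :
    Commute (hA.resolvent n) (hA.resolvent k) := by
  refine ContinuousLinearMap.ext fun f => ?_
  obtain ⟨x, hx, hf⟩ := hA.exists_resolvent_eq n f
  obtain ⟨y, hy, hAy⟩ := hA.exists_yosida_eq k (x : H)
  have hshift : hA.resolvent k f = y + (n + 1 : ℝ)⁻¹ • A y := by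
    rw [hf, map_add, map_smul, ← hA.yosida_coe, hy, hAy]
  change hA.resolvent n (hA.resolvent k f) = hA.resolvent k (hA.resolvent n f)
  rw [hshift, hA.resolvent_shift, hx, hy]

theorem commute_yosida (hA : IsMAccretive A) (n k : ℕ) :
    Commute (hA.yosida n) (hA.yosida k) :=
  ((((Commute.one_left _).sub_left ((Commute.one_right _).sub_right
    (hA.commute_resolvent n k))).smul_left _).smul_right _)

theorem tendsto_resolvent (hA : IsMAccretive A) (f : H) :
    Tendsto (fun n => hA.resolvent n f) atTop (𝓝 f) := by
  refine tendsto_clm_of_dense hA.dense hA.norm_resolvent_le (.id ℝ H) (fun V hV => ?_) f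
  lift V to A.domain using hV
  have hsub (n : ℕ) : V - hA.resolvent n V = (1 / (n + 1 : ℝ)) • hA.yosida n V := by
    rw [one_div]
    exact (inv_smul_smul₀ (by positivity : (n + 1 : ℝ) ≠ 0) _).symm
  have hlim : Tendsto (fun n : ℕ => 1 / (n + 1 : ℝ) * ‖A V‖) atTop (𝓝 0) := by
    simpa only [zero_mul] using tendsto_one_div_add_atTop_nhds_zero_nat.mul_const ‖A V‖
  rw [tendsto_iff_norm_sub_tendsto_zero]
  refine squeeze_zero (fun _ => norm_nonneg _) (fun n => ?_) hlim
  rw [ContinuousLinearMap.id_apply, norm_sub_rev, hsub, norm_smul,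
    Real.norm_of_nonneg (by positivity)]
  gcongr
  exact hA.norm_yosida_coe_le n V

theorem tendsto_yosida (hA : IsMAccretive A) (x : A.domain) :
    Tendsto (fun n => hA.yosida n x) atTop (𝓝 (A x)) := by
  simpa only [hA.yosida_coe] using hA.tendsto_resolvent (A x)

/-- The semigroup generated by minus the `n`-th Yosida approximation. -/
def approx (hA : IsMAccretive A) (n : ℕ) (t : ℝ) : H →L[ℝ] H :=
  NormedSpace.exp (t • -hA.yosida n)

theorem approx_zero (hA : IsMAccretive A) (n : ℕ) : hA.approx n 0 = 1 := by
  rw [approx, zero_smul, NormedSpace.exp_zero]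

theorem commute_yosida_approx (hA : IsMAccretive A) (n k : ℕ) (t : ℝ) :
    Commute (hA.yosida n) (hA.approx k t) :=
  ((hA.commute_yosida n k).neg_right.smul_right t).exp_right

variable [CompleteSpace H]

theorem approx_add (hA : IsMAccretive A) (n : ℕ) (s t : ℝ) :
    hA.approx n (s + t) = hA.approx n s * hA.approx n t := by
  let _ : NormedAlgebra ℚ (H →L[ℝ] H) := NormedAlgebra.restrictScalars ℚ ℝ _
  rw [approx, add_smul, NormedSpace.exp_add_of_commute
    (((Commute.refl _).smul_left s).smul_right t)]
  rfl

theorem norm_approx_le (hA : IsMAccretive A) (n : ℕ) {t : ℝ} (ht : 0 ≤ t) :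
    ‖hA.approx n t‖ ≤ 1 := by
  have hexp : t • -hA.yosida n = (t * (n + 1)) • (hA.resolvent n - 1) := by
    rw [yosida, ← smul_neg, neg_sub, smul_smul]
  rw [approx, hexp]
  exact norm_exp_smul_sub_one_le ContinuousLinearMap.norm_id_le (hA.norm_resolvent_le n)
    (by positivity)

theorem norm_approx_apply_le (hA : IsMAccretive A) (n : ℕ) {t : ℝ} (ht : 0 ≤ t) (f : H) :
    ‖hA.approx n t f‖ ≤ ‖f‖ := by
  simpa using (hA.approx n t).le_of_opNorm_le (hA.norm_approx_le n ht) f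

theorem hasDerivAt_approx (hA : IsMAccretive A) (n : ℕ) (t : ℝ) :
    HasDerivAt (hA.approx n) (hA.approx n t * -hA.yosida n) t :=
  hasDerivAt_exp_smul_const (-hA.yosida n) t

theorem hasDerivAt_approx_apply (hA : IsMAccretive A) (n : ℕ) (t : ℝ) (f : H) :
    HasDerivAt (fun t => hA.approx n t f) (-hA.approx n t (hA.yosida n f)) t := by
  simpa using (hA.hasDerivAt_approx n t).clm_apply (hasDerivAt_const t f)

theorem hasDerivAt_approx_approx_sub (hA : IsMAccretive A) (n k : ℕ) (s t : ℝ) (f : H) :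
    HasDerivAt (fun s => hA.approx n s (hA.approx k (t - s) f))
      (hA.approx n s (hA.approx k (t - s) (hA.yosida k f - hA.yosida n f))) s := by
  have hinner : HasDerivAt (fun s => hA.approx k (t - s) f)
      (hA.approx k (t - s) (hA.yosida k f)) s := by
    simpa [Function.comp_def] using
      (hA.hasDerivAt_approx_apply k (t - s) f).scomp s ((hasDerivAt_id s).const_sub t)
  convert (hA.hasDerivAt_approx n s).clm_apply hinner using 1
  have hcomm : hA.yosida n (hA.approx k (t - s) f) = hA.approx k (t - s) (hA.yosida n f) :=
    DFunLike.congr_fun (hA.commute_yosida_approx n k (t - s)).eq f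
  simp only [mul_apply_eq_comp, neg_apply, map_sub, map_neg, hcomm]
  abel

theorem norm_approx_sub_approx_le (hA : IsMAccretive A) (n k : ℕ) {t : ℝ} (ht : 0 ≤ t) (f : H) :
    ‖hA.approx n t f - hA.approx k t f‖ ≤ ‖hA.yosida n f - hA.yosida k f‖ * t := by
  have hmvt := norm_image_sub_le_of_norm_deriv_le_segment' (a := 0) (b := t)
    (C := ‖hA.yosida n f - hA.yosida k f‖)
    (fun s _ => (hA.hasDerivAt_approx_approx_sub n k s t f).hasDerivWithinAt) (fun s hs => ?_) t
    ⟨ht, le_rfl⟩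
  · simpa [hA.approx_zero] using hmvt
  · rw [norm_sub_rev]
    exact (hA.norm_approx_apply_le n hs.1 _).trans
      (hA.norm_approx_apply_le k (sub_nonneg.2 hs.2.le) _)

theorem cauchySeq_approx (hA : IsMAccretive A) {t : ℝ} (ht : 0 ≤ t) (f : H) :
    CauchySeq fun n => hA.approx n t f := by
  rw [cauchySeq_iff_tendsto_dist_atTop_0]
  simp only [dist_eq_norm, ← sub_apply, ← tendsto_zero_iff_norm_tendsto_zero]
  refine tendsto_clm_of_dense hA.dense (M := 1 + 1) (F' := 0) (fun p => ?_) (fun V hV => ?_) f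
  · exact (norm_sub_le _ _).trans
      (add_le_add (hA.norm_approx_le _ ht) (hA.norm_approx_le _ ht))
  · lift V to A.domain using hV
    have hyosida := cauchySeq_iff_tendsto_dist_atTop_0.1 (hA.tendsto_yosida V).cauchySeq
    refine squeeze_zero_norm (fun p => hA.norm_approx_sub_approx_le p.1 p.2 ht V) ?_
    simpa [dist_eq_norm] using hyosida.mul_const t

/-- The contraction semigroup generated by `-A`, extended to negative times by the identity. -/
def semigroup (hA : IsMAccretive A) (t : ℝ) : H →L[ℝ] H :=
  continuousLinearMapOfTendsto (l := atTop) (fun n => hA.approx n (max t 0))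
    (tendsto_pi_nhds.2 fun f =>
      CauchySeq.tendsto_limUnder (hA.cauchySeq_approx (le_max_right t 0) f))

theorem tendsto_approx_max (hA : IsMAccretive A) (t : ℝ) (f : H) :
    Tendsto (fun n => hA.approx n (max t 0) f) atTop (𝓝 (hA.semigroup t f)) :=
  CauchySeq.tendsto_limUnder (hA.cauchySeq_approx (le_max_right t 0) f)

theorem tendsto_approx (hA : IsMAccretive A) {t : ℝ} (ht : 0 ≤ t) (f : H) :
    Tendsto (fun n => hA.approx n t f) atTop (𝓝 (hA.semigroup t f)) := by
  simpa only [max_eq_left ht] using hA.tendsto_approx_max t f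

theorem semigroup_max (hA : IsMAccretive A) (t : ℝ) :
    hA.semigroup (max t 0) = hA.semigroup t := by
  ext f
  exact tendsto_nhds_unique (hA.tendsto_approx (le_max_right t 0) f) (hA.tendsto_approx_max t f)

theorem norm_semigroup_le (hA : IsMAccretive A) (t : ℝ) : ‖hA.semigroup t‖ ≤ 1 :=
  ContinuousLinearMap.opNorm_le_bound _ zero_le_one fun f => by
    simpa using le_of_tendsto (hA.tendsto_approx_max t f).norm
      (Eventually.of_forall fun n => hA.norm_approx_apply_le n (le_max_right t 0) f)

theorem norm_semigroup_apply_le (hA : IsMAccretive A) (t : ℝ) (f : H) :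
    ‖hA.semigroup t f‖ ≤ ‖f‖ := by
  simpa using (hA.semigroup t).le_of_opNorm_le (hA.norm_semigroup_le t) f

theorem semigroup_zero (hA : IsMAccretive A) : hA.semigroup 0 = .id ℝ H := by
  ext f
  refine tendsto_nhds_unique (hA.tendsto_approx le_rfl f) ?_
  simp [hA.approx_zero]

theorem semigroup_add (hA : IsMAccretive A) {s t : ℝ} (hs : 0 ≤ s) (ht : 0 ≤ t) :
    hA.semigroup (s + t) = (hA.semigroup s).comp (hA.semigroup t) := by
  ext f
  refine tendsto_nhds_unique (hA.tendsto_approx (add_nonneg hs ht) f) ?_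
  simp only [hA.approx_add, mul_apply_eq_comp]
  exact tendsto_clm_apply (F := fun n => hA.approx n s)
    (Eventually.of_forall fun n => hA.norm_approx_le n hs)
    (hA.tendsto_approx hs _) (hA.tendsto_approx ht f)

theorem approx_eq_sub_integral (hA : IsMAccretive A) (n : ℕ) (t : ℝ) (f : H) :
    hA.approx n t f = f - ∫ s in (0 : ℝ)..t, hA.approx n s (hA.yosida n f) := by
  have hcont : Continuous fun s => hA.approx n s (hA.yosida n f) :=
    continuous_iff_continuousAt.2 fun s => (hA.hasDerivAt_approx_apply n s _).continuousAt
  have hftc := intervalIntegral.integral_eq_sub_of_hasDerivAt (a := 0) (b := t)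
    (fun s _ => hA.hasDerivAt_approx_apply n s f) (hcont.neg.intervalIntegrable _ _)
  rw [intervalIntegral.integral_neg, hA.approx_zero, one_apply_eq_self] at hftc
  rw [sub_eq_add_neg, hftc, add_sub_cancel]

theorem semigroup_eq_sub_integral (hA : IsMAccretive A) {t : ℝ} (ht : 0 ≤ t) (x : A.domain) :
    hA.semigroup t x = x - ∫ s in (0 : ℝ)..t, hA.semigroup s (A x) := by
  refine tendsto_nhds_unique (hA.tendsto_approx ht x) ?_
  simp only [hA.approx_eq_sub_integral _ t]
  refine tendsto_const_nhds.sub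
    (intervalIntegral.tendsto_integral_filter_of_dominated_convergence (fun _ => ‖A x‖)
      (Eventually.of_forall fun n => ?_)
      (Eventually.of_forall fun n => Eventually.of_forall fun s hs => ?_)
      intervalIntegrable_const (Eventually.of_forall fun s hs => ?_))
  · exact (continuous_iff_continuousAt.2 fun s =>
      (hA.hasDerivAt_approx_apply n s _).continuousAt).aestronglyMeasurable
  all_goals rw [uIoc_of_le ht] at hs
  · exact (hA.norm_approx_apply_le n hs.1.le _).trans (hA.norm_yosida_coe_le n x)
  · exact tendsto_clm_apply (Eventually.of_forall fun n => hA.norm_approx_le n hs.1.le)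
      (hA.tendsto_approx hs.1.le _) (hA.tendsto_yosida x)

theorem norm_semigroup_sub_le (hA : IsMAccretive A) {t : ℝ} (ht : 0 ≤ t) (x : A.domain) :
    ‖hA.semigroup t x - x‖ ≤ ‖A x‖ * t := by
  rw [hA.semigroup_eq_sub_integral ht, sub_sub_cancel_left, norm_neg]
  simpa [abs_of_nonneg ht] using intervalIntegral.norm_integral_le_of_norm_le_const
    (a := 0) (b := t) fun s _ => hA.norm_semigroup_apply_le s (A x)

theorem tendsto_semigroup_zero (hA : IsMAccretive A) (f : H) :
    Tendsto (fun t => hA.semigroup t f) (𝓝[>] 0) (𝓝 f) := by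
  refine tendsto_clm_of_dense hA.dense hA.norm_semigroup_le (.id ℝ H) (fun V hV => ?_) f
  lift V to A.domain using hV
  have hlim : Tendsto (fun t : ℝ => ‖A V‖ * t) (𝓝[>] 0) (𝓝 0) := by
    have hcont : Continuous fun t : ℝ => ‖A V‖ * t := by fun_prop
    simpa using (hcont.tendsto 0).mono_left nhdsWithin_le_nhds
  rw [tendsto_iff_norm_sub_tendsto_zero]
  refine squeeze_zero' (Eventually.of_forall fun _ => norm_nonneg _) ?_ hlim
  filter_upwards [self_mem_nhdsWithin] with t ht using hA.norm_semigroup_sub_le (le_of_lt ht) V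

theorem isC0Semigroup (hA : IsMAccretive A) : IsC0Semigroup hA.semigroup where
  zero := hA.semigroup_zero
  add _ _ := hA.semigroup_add
  tendsto := hA.tendsto_semigroup_zero

theorem continuous_semigroup (hA : IsMAccretive A) (f : H) :
    Continuous fun t => hA.semigroup t f := by
  have hcomp : Continuous fun t => hA.semigroup (max t 0) f :=
    (hA.isC0Semigroup.continuousOn f).comp_continuous (continuous_id.max continuous_const)
      fun t => le_max_right t 0
  simpa only [hA.semigroup_max] using hcomp

theorem continuous_uncurry_semigroup (hA : IsMAccretive A) :
    Continuous fun p : ℝ × H => hA.semigroup p.1 p.2 :=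
  continuous_iff_continuousAt.2 fun p =>
    tendsto_clm_apply (Eventually.of_forall fun q => hA.norm_semigroup_le q.1)
      ((hA.continuous_semigroup p.2).tendsto p.1 |>.comp continuousAt_fst) continuousAt_snd

theorem isGenerator_coe (hA : IsMAccretive A) (x : A.domain) :
    IsGenerator hA.semigroup x (-A x) := by
  have hcont := hA.continuous_semigroup (A x)
  have hint : HasDerivAt (fun t => ∫ s in (0 : ℝ)..t, hA.semigroup s (A x)) (A x) 0 := by
    simpa [hA.semigroup_zero] using hcont.integral_hasStrictDerivAt 0 0 |>.hasDerivAt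
  refine ((hasDerivWithinAt_iff_tendsto_slope' (s := Ioi (0 : ℝ)) (by simp)).1
    hint.neg.hasDerivWithinAt).congr' ?_
  filter_upwards [self_mem_nhdsWithin] with t ht
  simp [slope_def_module, hA.semigroup_eq_sub_integral (le_of_lt ht)]

theorem eq_zero_of_isGenerator_self (hA : IsMAccretive A) {y : H}
    (h : IsGenerator hA.semigroup y y) : y = 0 := by
  have hlim : Tendsto (fun t : ℝ => ‖t⁻¹ • (hA.semigroup t y - y) - y‖) (𝓝[>] 0) (𝓝 0) :=
    tendsto_iff_norm_sub_tendsto_zero.1 h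
  refine norm_le_zero_iff.1 (ge_of_tendsto hlim ?_)
  filter_upwards [self_mem_nhdsWithin] with t (ht : 0 < t)
  have hsplit : (1 + t⁻¹) • y =
      t⁻¹ • hA.semigroup t y - (t⁻¹ • (hA.semigroup t y - y) - y) := by module
  have hnorm : (1 + t⁻¹) * ‖y‖ ≤
      t⁻¹ * ‖y‖ + ‖t⁻¹ • (hA.semigroup t y - y) - y‖ := by
    calc (1 + t⁻¹) * ‖y‖ = ‖(1 + t⁻¹) • y‖ := by
          rw [norm_smul, Real.norm_of_nonneg (by positivity)]
      _ ≤ ‖t⁻¹ • hA.semigroup t y‖ + ‖t⁻¹ • (hA.semigroup t y - y) - y‖ := by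
          rw [hsplit]; exact norm_sub_le _ _
      _ ≤ t⁻¹ * ‖y‖ + ‖t⁻¹ • (hA.semigroup t y - y) - y‖ := by
          rw [norm_smul, Real.norm_of_nonneg (by positivity)]
          gcongr
          exact hA.norm_semigroup_apply_le t y
  linarith

theorem isGenerator_iff (hA : IsMAccretive A) {V W : H} :
    IsGenerator hA.semigroup V W ↔ (V, -W) ∈ A.graph := by
  rw [LinearPMap.mem_graph_iff]
  constructor
  · intro h
    obtain ⟨x, hx : (x : H) + (1 : ℝ) • A x = V - W⟩ := hA.surjective 1 one_pos (V - W)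
    rw [one_smul] at hx
    have hdiff : W - -A x = V - x := by
      rw [sub_neg_eq_add, eq_sub_iff_add_eq, add_assoc, add_comm (A x), hx, add_sub_cancel]
    have hself : IsGenerator hA.semigroup (V - x) (V - x) := by
      have hsub := h.sub (hA.isGenerator_coe x)
      rw [hdiff] at hsub
      refine hsub.congr fun t => ?_
      rw [map_sub, ← smul_sub, sub_sub_sub_comm]
    have hVx : V = x := sub_eq_zero.1 (hA.eq_zero_of_isGenerator_self hself)
    exact ⟨x, hVx.symm, by rwa [hVx, sub_eq_add_neg, add_right_inj] at hx⟩
  · rintro ⟨x, rfl, hx⟩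
    simpa [hx] using hA.isGenerator_coe x

theorem eq_semigroup (hA : IsMAccretive A) {G : ℝ → H →L[ℝ] H} (hG : IsC0Semigroup G)
    (hgen : ∀ V W, IsGenerator G V W ↔ (V, -W) ∈ A.graph) {t : ℝ} (ht : 0 ≤ t) :
    G t = hA.semigroup t := by
  refine hG.eq_of_isGenerator hA.isC0Semigroup (hA.dense.mono fun V hV => ⟨-A ⟨V, hV⟩, ?_⟩)
    (fun V W h => hA.isGenerator_iff.2 ((hgen V W).1 h)) ht
  simp only [hgen, neg_neg]
  exact A.mem_graph ⟨V, hV⟩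

end IsMAccretive

end HilleYosida

/-! ### The Maxwell operator -/

section SkewBlock

theorem IsMAccretive.of_inner_nonneg {H : Type} [NormedAddCommGroup H] [InnerProductSpace ℝ H]
    [CompleteSpace H] {A : H →ₗ.[ℝ] H} (hinner : ∀ x : A.domain, 0 ≤ inner ℝ (x : H) (A x))
    (hsurj : ∀ ε : ℝ, 0 < ε → Function.Surjective fun x : A.domain => (x : H) + ε • A x) :
    IsMAccretive A where
  dense := by
    rw [Submodule.dense_iff_topologicalClosure_eq_top, Submodule.topologicalClosure_eq_top_iff,
      eq_bot_iff]
    intro Z hZ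
    obtain ⟨x, hx : (x : H) + (1 : ℝ) • A x = Z⟩ := hsurj 1 one_pos Z
    have hxZ : inner ℝ (x : H) Z = 0 := (Submodule.mem_orthogonal _ _).1 hZ x x.2
    rw [← hx, one_smul, inner_add_right, real_inner_self_eq_norm_sq] at hxZ
    have hx0 : x = 0 := by
      have hsq : ‖(x : H)‖ ^ 2 = 0 := by nlinarith [hinner x, sq_nonneg ‖(x : H)‖]
      simpa using hsq
    simp [← hx, hx0]
  norm_le ε hε x := by
    refine le_of_sq_le_sq ?_ (norm_nonneg _)
    rw [norm_add_sq_real, real_inner_smul_right]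
    nlinarith [mul_nonneg hε.le (hinner x), sq_nonneg ‖ε • A x‖]
  surjective := hsurj

variable {E F : Type} [NormedAddCommGroup E] [InnerProductSpace ℝ E]
  [NormedAddCommGroup F] [InnerProductSpace ℝ F]

theorem isClosed_adjoint (g : Submodule ℝ (E × F)) : IsClosed (g.adjoint : Set (F × E)) := by
  have hset : (g.adjoint : Set (F × E)) =
      {x | ∀ a b, (a, b) ∈ g → inner ℝ b x.1 - inner ℝ a x.2 = 0} :=
    Set.ext (Submodule.mem_adjoint_iff g)
  simp only [hset, ofPred_forall]
  exact isClosed_iInter fun a => isClosed_iInter fun b => isClosed_iInter fun _ =>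
    isClosed_eq (by fun_prop) continuous_const

/-- The graph of the block operator `(V₁, V₂) ↦ (-T V₂, T† V₁)`, where `T` is given by its graph. -/
def skewBlock (T : Submodule ℝ (F × E)) : Submodule ℝ (WithLp 2 (E × F) × WithLp 2 (E × F)) where
  carrier := {p | (p.1.fst, p.2.snd) ∈ T.adjoint ∧ (p.1.snd, -p.2.fst) ∈ T}
  add_mem' hp hp' := ⟨T.adjoint.add_mem hp.1 hp'.1, by
    simpa [add_comm] using T.add_mem hp.2 hp'.2⟩
  zero_mem' := ⟨T.adjoint.zero_mem, by
    rw [Prod.snd_zero, WithLp.zero_fst, neg_zero]; exact T.zero_mem⟩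
  smul_mem' a p hp := ⟨T.adjoint.smul_mem a hp.1, by simpa using T.smul_mem a hp.2⟩

variable {T : Submodule ℝ (F × E)}

theorem mem_skewBlock {V W : WithLp 2 (E × F)} :
    (V, W) ∈ skewBlock T ↔ (V.fst, W.snd) ∈ T.adjoint ∧ (V.snd, -W.fst) ∈ T :=
  Iff.rfl

theorem inner_eq_zero_of_mem_skewBlock {V W : WithLp 2 (E × F)} (h : (V, W) ∈ skewBlock T) :
    inner ℝ V W = 0 := by
  have hadj := (Submodule.mem_adjoint_iff _ _).1 h.1 _ _ h.2
  rw [inner_neg_left, real_inner_comm V.fst] at hadj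
  rw [WithLp.prod_inner_apply]
  exact neg_eq_zero.1 (by rw [← hadj]; ring!)

/-- Von Neumann's argument: the orthogonal complement of the graph of `ε T` is, up to a rotation,
the graph of the adjoint of `ε T`. -/
theorem exists_mem_skewBlock_add_smul_eq [CompleteSpace E] [CompleteSpace F]
    (hT : IsClosed (T : Set (F × E))) {ε : ℝ} (hε : 0 < ε) (f : WithLp 2 (E × F)) :
    ∃ V W, (V, W) ∈ skewBlock T ∧ V + ε • W = f := by
  let unscale : WithLp 2 (F × E) →L[ℝ] F × E :=
    ((ContinuousLinearMap.id ℝ F).prodMap (ε⁻¹ • ContinuousLinearMap.id ℝ E)).comp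
      (WithLp.prodContinuousLinearEquiv 2 ℝ F E).toContinuousLinearMap
  let graph : Submodule ℝ (WithLp 2 (F × E)) := T.comap unscale.toLinearMap
  have : CompleteSpace graph := (hT.preimage unscale.continuous).completeSpace_coe
  obtain ⟨y, hy, z, hz, hyz⟩ := graph.exists_add_mem_mem_orthogonal (WithLp.toLp 2 (f.snd, -f.fst))
  have hsnd : f.snd = y.fst + z.fst := congrArg WithLp.fst hyz
  have hfst : -f.fst = y.snd + z.snd := congrArg WithLp.snd hyz
  refine ⟨WithLp.toLp 2 (-z.snd, y.fst), WithLp.toLp 2 (-(ε⁻¹ • y.snd), ε⁻¹ • z.fst),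
    ⟨(Submodule.mem_adjoint_iff _ _).2 fun P Q hPQ => ?_, ?_⟩, ?_⟩
  · have horth : inner ℝ P z.fst + inner ℝ (ε • Q) z.snd = 0 :=
      (Submodule.mem_orthogonal _ _).1 hz (WithLp.toLp 2 (P, ε • Q))
        (by change (P, ε⁻¹ • ε • Q) ∈ T; rwa [inv_smul_smul₀ hε.ne'])
    change inner ℝ Q (-z.snd) - inner ℝ P (ε⁻¹ • z.fst) = 0
    rw [real_inner_smul_left] at horth
    rw [inner_neg_right, real_inner_smul_right]
    field_simp
    linarith
  · change (y.fst, - -(ε⁻¹ • y.snd)) ∈ T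
    rw [neg_neg]
    exact hy
  · apply (WithLp.equiv 2 _).injective
    refine Prod.ext ?_ ?_
    · change -z.snd + ε • -(ε⁻¹ • y.snd) = f.fst
      rw [smul_neg, smul_inv_smul₀ hε.ne', ← neg_inj, hfst]; abel
    · change y.fst + ε • ε⁻¹ • z.fst = f.snd
      rw [smul_inv_smul₀ hε.ne', hsnd]

theorem eq_zero_of_mem_skewBlock (hT : ∀ y, (0, y) ∈ T → y = 0)
    (hT' : ∀ x, (0, x) ∈ T.adjoint → x = 0) {W : WithLp 2 (E × F)} (h : (0, W) ∈ skewBlock T) :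
    W = 0 :=
  (WithLp.equiv 2 _).injective (Prod.ext (neg_eq_zero.1 (hT _ h.2)) (hT' _ h.1))

theorem graph_toLinearPMap_skewBlock (hT : ∀ y, (0, y) ∈ T → y = 0)
    (hT' : ∀ x, (0, x) ∈ T.adjoint → x = 0) :
    (skewBlock T).toLinearPMap.graph = skewBlock T :=
  Submodule.toLinearPMap_graph_eq _ fun p hp hp0 =>
    eq_zero_of_mem_skewBlock hT hT' (by rwa [← hp0])

theorem isMAccretive_skewBlock [CompleteSpace E] [CompleteSpace F]
    (hclosed : IsClosed (T : Set (F × E))) (hT : ∀ y, (0, y) ∈ T → y = 0)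
    (hT' : ∀ x, (0, x) ∈ T.adjoint → x = 0) : IsMAccretive (skewBlock T).toLinearPMap := by
  have hgraph := graph_toLinearPMap_skewBlock hT hT'
  refine .of_inner_nonneg (fun x => ?_) fun ε hε f => ?_
  · exact (inner_eq_zero_of_mem_skewBlock (hgraph ▸ LinearPMap.mem_graph _ x)).ge
  · obtain ⟨V, W, hVW, rfl⟩ := exists_mem_skewBlock_add_smul_eq hclosed hε f
    rw [← hgraph, LinearPMap.mem_graph_iff] at hVW
    obtain ⟨x, rfl, rfl⟩ := hVW
    exact ⟨x, rfl⟩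

end SkewBlock

section TestFunctions

variable {Ω : Set R3} {F : Type} [NormedAddCommGroup F] [NormedSpace ℝ F]

theorem IsTest.memLp {ψ : R3 → F} (h : IsTest Ω ψ) : MemLp ψ 2 (vol Ω) :=
  (h.1.continuous.memLp_of_hasCompactSupport h.2.1).restrict Ω

theorem IsTest.eq_zero_of_notMem {ψ : R3 → F} (h : IsTest Ω ψ) {x : R3} (hx : x ∉ Ω) : ψ x = 0 :=
  image_eq_zero_of_notMem_tsupport fun hm => hx (h.2.2 hm)

theorem IsTest.smul_const {g : R3 → ℝ} (hg : IsTest Ω g) (a : F) : IsTest Ω fun x => g x • a :=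
  ⟨hg.1.smul contDiff_const, hg.2.1.smul_right,
    (closure_mono (Function.support_smul_subset_left g fun _ => a)).trans hg.2.2⟩

theorem eq_zero_of_integral_smul_test [CompleteSpace F] (hΩ : IsOpen Ω) (V : Lp F 2 (vol Ω))
    (h : ∀ g : R3 → ℝ, IsTest Ω g → ∫ x, g x • V x ∂(vol Ω) = 0) : V = 0 := by
  have hloc : LocallyIntegrable V (vol Ω) := (Lp.memLp V).locallyIntegrable one_le_two
  have hae := hΩ.ae_eq_zero_of_integral_contDiff_smul_eq_zero (μ := vol Ω)
    (hloc.locallyIntegrableOn _) fun g hg hc hs => h g ⟨hg, hc, hs⟩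
  rw [Lp.eq_zero_iff_ae_eq_zero]
  filter_upwards [hae, ae_restrict_mem hΩ.measurableSet] with x hx hxΩ
  exact hx hxΩ

theorem eq_zero_of_integral_mul_test (hΩ : IsOpen Ω) (v : L2 Ω)
    (h : ∀ ψ : R3 → ℝ, IsTest Ω ψ → ∫ x, v x * ψ x ∂(vol Ω) = 0) : v = 0 :=
  eq_zero_of_integral_smul_test hΩ v fun g hg => by
    simpa only [smul_eq_mul, mul_comm] using h g hg

theorem eq_zero_of_integral_inner_test {F : Type} [NormedAddCommGroup F] [InnerProductSpace ℝ F]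
    [CompleteSpace F] (hΩ : IsOpen Ω) (V : Lp F 2 (vol Ω))
    (h : ∀ ψ : R3 → F, IsTest Ω ψ → ∫ x, inner ℝ (V x) (ψ x) ∂(vol Ω) = 0) : V = 0 := by
  refine eq_zero_of_integral_smul_test hΩ V fun g hg => ext_inner_right ℝ fun a => ?_
  have hint : Integrable (fun x => g x • V x) (vol Ω) :=
    memLp_one_iff_integrable.1 ((Lp.memLp V).smul hg.memLp)
  rw [inner_zero_left, real_inner_comm, ← integral_inner hint, ← h _ (hg.smul_const a)]
  simp only [inner_smul_right, real_inner_comm]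

theorem inner_toLp_right {α : Type*} [MeasurableSpace α] {F : Type*} [NormedAddCommGroup F]
    [InnerProductSpace ℝ F] {μ : Measure α} (V : Lp F 2 μ) {f : α → F} (hf : MemLp f 2 μ) :
    inner ℝ V hf.toLp = ∫ x, inner ℝ (V x) (f x) ∂μ := by
  rw [L2.inner_def]
  refine integral_congr_ae ?_
  filter_upwards [hf.coeFn_toLp] with x hx
  rw [hx]

end TestFunctions

section Curl

variable {Ω : Set R3} {ψ χ : R3 → R3}

theorem hasFDerivAt_apply (hψ : ContDiff ℝ ∞ ψ) (k : Fin 3) (x : R3) :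
    HasFDerivAt (fun x => ψ x k) ((EuclideanSpace.proj k : R3 →L[ℝ] ℝ).comp (fderiv ℝ ψ x)) x :=
  (EuclideanSpace.proj k : R3 →L[ℝ] ℝ).hasFDerivAt.comp x
    (hψ.differentiable (by simp) x).hasFDerivAt

theorem partialD_eq (hψ : ContDiff ℝ ∞ ψ) (i k : Fin 3) (x : R3) :
    partialD ψ i k x = fderiv ℝ (fun x => ψ x k) x (EuclideanSpace.single i 1) := by
  rw [(hasFDerivAt_apply hψ k x).fderiv]; rfl

theorem continuous_apply_comp {ψ : R3 → R3} (hψ : Continuous ψ) (k : Fin 3) :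
    Continuous fun x => ψ x k :=
  (EuclideanSpace.proj k : R3 →L[ℝ] ℝ).continuous.comp hψ

theorem continuous_partialD (hψ : ContDiff ℝ ∞ ψ) (i k : Fin 3) : Continuous (partialD ψ i k) :=
  continuous_apply_comp ((hψ.continuous_fderiv (by simp)).clm_apply continuous_const) k

theorem continuous_curl (hψ : ContDiff ℝ ∞ ψ) : Continuous (curl ψ) := by
  refine (PiLp.continuous_toLp 2 _).comp (continuous_pi fun i => ?_)
  fin_cases i <;> exact (continuous_partialD hψ _ _).sub (continuous_partialD hψ _ _)

theorem curl_eq_zero {x : R3} (hx : x ∉ tsupport ψ) : curl ψ x = 0 := by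
  have hfderiv : fderiv ℝ ψ x = 0 := by
    contrapose! hx
    exact support_fderiv_subset ℝ hx
  ext i
  fin_cases i <;> simp [curl, partialD, hfderiv]

theorem memLp_curl (h : IsTest Ω ψ) : MemLp (curl ψ) 2 (vol Ω) :=
  ((continuous_curl h.1).memLp_of_hasCompactSupport
    (HasCompactSupport.intro h.2.1 fun _ hx => curl_eq_zero hx)).restrict Ω

theorem integrable_apply_mul (hψ : IsTest Ω ψ) {f : R3 → ℝ} (hf : Continuous f) (k : Fin 3) :
    Integrable fun x => ψ x k * f x := by
  refine ((continuous_apply_comp hψ.1.continuous k).mul hf).integrable_of_hasCompactSupport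
    (.intro hψ.2.1 fun x hx => ?_)
  simp [image_eq_zero_of_notMem_tsupport hx]

theorem integral_apply_mul_partialD (hψ : IsTest Ω ψ) (hχ : IsTest Ω χ) (k i j : Fin 3) :
    ∫ x, ψ x k * partialD χ i j x = -∫ x, χ x j * partialD ψ i k x := by
  have hψχ := integrable_apply_mul hψ (continuous_partialD hχ.1 i j) k
  have hχψ := integrable_apply_mul hχ (continuous_partialD hψ.1 i k) j
  simp only [partialD_eq hψ.1, partialD_eq hχ.1, mul_comm (χ _ j)] at hψχ hχψ ⊢
  exact integral_mul_fderiv_eq_neg_fderiv_mul_of_integrable hχψ hψχ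
    (integrable_apply_mul hψ (continuous_apply_comp hχ.1.continuous j) k)
    (fun x _ => (hasFDerivAt_apply hψ.1 k x).differentiableAt)
    (fun x _ => (hasFDerivAt_apply hχ.1 j x).differentiableAt)

theorem integral_inner_curl (hψ : IsTest Ω ψ) (hχ : IsTest Ω χ) :
    ∫ x, inner ℝ (ψ x) (curl χ x) =
      ((∫ x, ψ x 0 * partialD χ 1 2 x) - ∫ x, ψ x 0 * partialD χ 2 1 x) +
      ((∫ x, ψ x 1 * partialD χ 2 0 x) - ∫ x, ψ x 1 * partialD χ 0 2 x) +
      ((∫ x, ψ x 2 * partialD χ 0 1 x) - ∫ x, ψ x 2 * partialD χ 1 0 x) := by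
  have hint (k i j : Fin 3) : Integrable fun x => ψ x k * partialD χ i j x :=
    integrable_apply_mul hψ (continuous_partialD hχ.1 i j) k
  have hexpand (x : R3) : inner ℝ (ψ x) (curl χ x) =
      (ψ x 0 * partialD χ 1 2 x - ψ x 0 * partialD χ 2 1 x) +
      (ψ x 1 * partialD χ 2 0 x - ψ x 1 * partialD χ 0 2 x) +
      (ψ x 2 * partialD χ 0 1 x - ψ x 2 * partialD χ 1 0 x) := by
    simp only [PiLp.inner_apply, Fin.sum_univ_three, curl, RCLike.inner_apply, conj_trivial]
    simp
    ring
  have hsub (k i j i' j' : Fin 3) :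
      Integrable fun x => ψ x k * partialD χ i j x - ψ x k * partialD χ i' j' x :=
    (hint k i j).sub (hint k i' j')
  simp_rw [hexpand]
  rw [integral_add ((hsub _ _ _ _ _).fun_add (hsub _ _ _ _ _)) (hsub _ _ _ _ _),
    integral_add (hsub _ _ _ _ _) (hsub _ _ _ _ _)]
  simp only [integral_sub (hint _ _ _) (hint _ _ _)]

theorem integral_inner_curl_comm (hψ : IsTest Ω ψ) (hχ : IsTest Ω χ) :
    ∫ x, inner ℝ (ψ x) (curl χ x) ∂(vol Ω) = ∫ x, inner ℝ (curl ψ x) (χ x) ∂(vol Ω) := by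
  rw [setIntegral_eq_integral_of_forall_compl_eq_zero fun x hx => by
      rw [hψ.eq_zero_of_notMem hx, inner_zero_left],
    setIntegral_eq_integral_of_forall_compl_eq_zero fun x hx => by
      rw [hχ.eq_zero_of_notMem hx, inner_zero_right]]
  simp_rw [real_inner_comm (χ _)]
  rw [integral_inner_curl hψ hχ, integral_inner_curl hχ hψ]
  simp only [integral_apply_mul_partialD hψ hχ]
  ring

end Curl

section MaxwellOperator

variable {Ω : Set R3} {V W : X Ω}

/-- The graph of the curl on test fields. Its adjoint is the weak curl on `H(curl; Ω)`, and the
adjoint of the weak curl is the curl on the fields with vanishing tangential trace. -/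
def testCurl (Ω : Set R3) : Submodule ℝ (X Ω × X Ω) :=
  Submodule.span ℝ (range fun ψ : {ψ : R3 → R3 // IsTest Ω ψ} =>
    (ψ.2.memLp.toLp, (memLp_curl ψ.2).toLp))

theorem toLp_mem_testCurl {ψ : R3 → R3} (h : IsTest Ω ψ) :
    (h.memLp.toLp, (memLp_curl h).toLp) ∈ testCurl Ω :=
  Submodule.subset_span ⟨⟨ψ, h⟩, rfl⟩

theorem mem_adjoint_testCurl : (V, W) ∈ (testCurl Ω).adjoint ↔ HasWeakCurl Ω V W := by
  have hequiv : HasWeakCurl Ω V W ↔ ∀ ψ (h : IsTest Ω ψ),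
      inner ℝ (memLp_curl h).toLp V - inner ℝ h.memLp.toLp W = 0 := by
    simp_rw [HasWeakCurl, sub_eq_zero, real_inner_comm _ (MemLp.toLp _ _), inner_toLp_right]
  rw [hequiv, Submodule.mem_adjoint_iff]
  refine ⟨fun h ψ hψ => h _ _ (toLp_mem_testCurl hψ), fun h P Q hPQ => ?_⟩
  refine Submodule.span_induction (p := fun q _ => inner ℝ q.2 V - inner ℝ q.1 W = 0)
    (by rintro _ ⟨ψ, rfl⟩; exact h _ ψ.2) (by simp) (fun q q' _ _ hq hq' => ?_)
    (fun a q _ hq => ?_) hPQ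
  · simp only [Prod.fst_add, Prod.snd_add, inner_add_left]
    rw [add_sub_add_comm, hq, hq', add_zero]
  · simp only [Prod.smul_fst, Prod.smul_snd, real_inner_smul_left]
    rw [← mul_sub, hq, mul_zero]

theorem testCurl_le_adjoint : testCurl Ω ≤ (testCurl Ω).adjoint := by
  refine Submodule.span_le.2 ?_
  rintro _ ⟨⟨ψ, hψ⟩, rfl⟩
  refine mem_adjoint_testCurl.2 fun χ hχ => ?_
  calc ∫ x, inner ℝ ((hψ.memLp.toLp ψ : X Ω) x) (curl χ x) ∂(vol Ω)
      = ∫ x, inner ℝ (ψ x) (curl χ x) ∂(vol Ω) := by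
        refine integral_congr_ae ?_
        filter_upwards [hψ.memLp.coeFn_toLp] with x hx
        rw [hx]
    _ = ∫ x, inner ℝ (curl ψ x) (χ x) ∂(vol Ω) := integral_inner_curl_comm hψ hχ
    _ = ∫ x, inner ℝ (((memLp_curl hψ).toLp (curl ψ) : X Ω) x) (χ x) ∂(vol Ω) := by
        refine integral_congr_ae ?_
        filter_upwards [(memLp_curl hψ).coeFn_toLp] with x hx
        rw [hx]

theorem mem_adjoint_adjoint_testCurl :
    (V, W) ∈ (testCurl Ω).adjoint.adjoint ↔ HasWeakCurlZeroTrace Ω V W := by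
  have htrace : (V, W) ∈ (testCurl Ω).adjoint.adjoint ↔
      ∀ P Q : X Ω, HasWeakCurl Ω P Q → inner ℝ W P = inner ℝ V Q := by
    simp only [Submodule.mem_adjoint_iff (testCurl Ω).adjoint, mem_adjoint_testCurl]
    exact forall₃_congr fun P Q _ => by
      rw [sub_eq_zero, real_inner_comm, real_inner_comm W, eq_comm]
  refine ⟨fun h => ⟨?_, htrace.1 h⟩, fun h => htrace.2 h.2⟩
  rw [← mem_adjoint_testCurl, Submodule.mem_adjoint_iff]
  exact fun P Q hPQ => (Submodule.mem_adjoint_iff _ _).1 h P Q (testCurl_le_adjoint hPQ)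

theorem HasWeakCurl.eq_zero (hΩ : IsOpen Ω) (h : HasWeakCurl Ω 0 W) : W = 0 := by
  refine eq_zero_of_integral_inner_test hΩ W fun ψ hψ => ?_
  have hzero := mem_adjoint_testCurl.2 h
  have := (Submodule.mem_adjoint_iff _ _).1 hzero _ _ (toLp_mem_testCurl hψ)
  rwa [inner_zero_right, zero_sub, neg_eq_zero, real_inner_comm, inner_toLp_right] at this

/-- The Maxwell operator `𝒜` on `X × X`, as a partially defined linear map. -/
def maxwell (Ω : Set R3) : XX Ω →ₗ.[ℝ] XX Ω :=
  (skewBlock (testCurl Ω).adjoint).toLinearPMap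

theorem mem_graph_maxwell (hΩ : IsOpen Ω) {V W : XX Ω} :
    (V, W) ∈ (maxwell Ω).graph ↔ IsMaxwellOp Ω V W := by
  rw [maxwell, graph_toLinearPMap_skewBlock (fun _ h => (mem_adjoint_testCurl.1 h).eq_zero hΩ)
      fun _ h => (mem_adjoint_adjoint_testCurl.1 h).1.eq_zero hΩ, mem_skewBlock,
    mem_adjoint_testCurl, mem_adjoint_adjoint_testCurl, IsMaxwellOp]

theorem isMAccretive_maxwell (hΩ : IsOpen Ω) : IsMAccretive (maxwell Ω) :=
  isMAccretive_skewBlock (isClosed_adjoint _) (fun _ h => (mem_adjoint_testCurl.1 h).eq_zero hΩ)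
    fun _ h => (mem_adjoint_adjoint_testCurl.1 h).1.eq_zero hΩ

theorem isMaxwellSemigroup_semigroup (hΩ : IsOpen Ω) :
    IsMaxwellSemigroup Ω (isMAccretive_maxwell hΩ).semigroup :=
  ⟨(isMAccretive_maxwell hΩ).isC0Semigroup, fun _ _ => by
    rw [(isMAccretive_maxwell hΩ).isGenerator_iff, mem_graph_maxwell hΩ]⟩

theorem IsMaxwellSemigroup.eq_semigroup (hΩ : IsOpen Ω) {G : ℝ → XX Ω →L[ℝ] XX Ω}
    (hG : IsMaxwellSemigroup Ω G) {t : ℝ} (ht : 0 ≤ t) :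
    G t = (isMAccretive_maxwell hΩ).semigroup t :=
  (isMAccretive_maxwell hΩ).eq_semigroup hG.1
    (fun V W => by rw [hG.2, mem_graph_maxwell hΩ]) ht

end MaxwellOperator

/-! ### Very weak solutions of the Poisson equation -/

section VeryWeakSolution

variable {Ω : Set R3}

theorem integral_mul_eq_inner {α : Type*} [MeasurableSpace α] {μ : Measure α} (f g : Lp ℝ 2 μ) :
    ∫ x, f x * g x ∂μ = inner ℝ f g := by
  simp only [L2.inner_def, RCLike.inner_apply, conj_trivial, mul_comm]

theorem integral_mul_eq_inner_toLp {α : Type*} [MeasurableSpace α] {μ : Measure α} (f : Lp ℝ 2 μ)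
    {ψ : α → ℝ} (hψ : MemLp ψ 2 μ) : ∫ x, f x * ψ x ∂μ = inner ℝ f hψ.toLp := by
  simp only [inner_toLp_right, RCLike.inner_apply, conj_trivial, mul_comm]

theorem continuous_gradient {ψ : R3 → ℝ} (hψ : ContDiff ℝ 1 ψ) : Continuous (gradient ψ) :=
  (InnerProductSpace.toDual ℝ R3).symm.continuous.comp (hψ.continuous_fderiv (by simp))

theorem hasCompactSupport_gradient {ψ : R3 → ℝ} (hc : HasCompactSupport ψ) :
    HasCompactSupport (gradient ψ) :=
  (hc.fderiv ℝ).comp_left (g := (InnerProductSpace.toDual ℝ R3).symm) (map_zero _)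

theorem memLp_of_contDiff {μ : Measure R3} [IsFiniteMeasureOnCompacts μ] {ψ : R3 → ℝ}
    (hψ : ContDiff ℝ ∞ ψ) (hc : HasCompactSupport ψ) : MemLp ψ 2 μ :=
  hψ.continuous.memLp_of_hasCompactSupport hc

theorem memLp_gradient {μ : Measure R3} [IsFiniteMeasureOnCompacts μ] {ψ : R3 → ℝ}
    (hψ : ContDiff ℝ ∞ ψ) (hc : HasCompactSupport ψ) : MemLp (gradient ψ) 2 μ :=
  (continuous_gradient (hψ.of_le (by simp))).memLp_of_hasCompactSupport
    (hasCompactSupport_gradient hc)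

theorem hasWeakDiv_iff {F : X Ω} {d : L2 Ω} : HasWeakDiv Ω F d ↔ ∀ ψ (h : IsTest Ω ψ),
    inner ℝ F (memLp_gradient h.1 h.2.1).toLp = -inner ℝ d h.memLp.toLp := by
  refine forall₂_congr fun ψ h => ?_
  rw [inner_toLp_right, integral_mul_eq_inner_toLp]

theorem hasNormalTrace_iff [IsFiniteMeasure (surf Ω)] {F : X Ω} {d : L2 Ω} {g : L2Γ Ω} :
    HasNormalTrace Ω F d g ↔ ∀ ψ (h : ContDiff ℝ ∞ ψ) (hc : HasCompactSupport ψ),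
      inner ℝ F (memLp_gradient h hc).toLp + inner ℝ d (memLp_of_contDiff h hc).toLp =
        inner ℝ g (memLp_of_contDiff h hc).toLp := by
  refine forall₃_congr fun ψ h hc => ?_
  rw [inner_toLp_right, integral_mul_eq_inner_toLp _ (memLp_of_contDiff h hc),
    integral_mul_eq_inner_toLp _ (memLp_of_contDiff h hc)]

theorem isWeakPoisson_iff {g : L2 Ω} {w : HSpace Ω} : IsWeakPoisson Ω g w ↔
    ∀ (v : L2 Ω) (G : X Ω), IsH10 Ω v G → inner ℝ w.grad G = inner ℝ g v := by
  simp_rw [IsWeakPoisson, integral_mul_eq_inner, L2.inner_def]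

theorem isVeryWeakSolution_iff {u : L2Γ Ω} {η : L2 Ω} : IsVeryWeakSolution Ω u η ↔
    ∀ v : HSpace Ω, -inner ℝ η v.lap + inner ℝ u v.normalDeriv = 0 := by
  simp_rw [IsVeryWeakSolution, integral_mul_eq_inner]

theorem IsTest.add {F : Type} [NormedAddCommGroup F] [NormedSpace ℝ F] {ψ χ : R3 → F}
    (hψ : IsTest Ω ψ) (hχ : IsTest Ω χ) : IsTest Ω (ψ + χ) :=
  ⟨hψ.1.add hχ.1, hψ.2.1.add hχ.2.1, (tsupport_add ψ χ).trans (union_subset hψ.2.2 hχ.2.2)⟩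

theorem IsTest.const_smul {F : Type} [NormedAddCommGroup F] [NormedSpace ℝ F] {ψ : R3 → F}
    (a : ℝ) (hψ : IsTest Ω ψ) : IsTest Ω (a • ψ) :=
  ⟨hψ.1.const_smul a, hψ.2.1.smul_left (f := fun _ => a),
    (closure_mono (Function.support_const_smul_subset a ψ)).trans hψ.2.2⟩

/-- The pairs `(ψ, ∇ψ)` with a test function `ψ`; the closure is the graph of the gradient on
`H¹₀(Ω)`. -/
def testPairs (Ω : Set R3) : Submodule ℝ (L2 Ω × X Ω) where
  carrier := {P : L2 Ω × X Ω | ∃ ψ : R3 → ℝ, IsTest Ω ψ ∧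
    P.1 =ᵐ[vol Ω] ψ ∧ P.2 =ᵐ[vol Ω] gradient ψ}
  add_mem' := by
    rintro ⟨v, G⟩ ⟨v', G'⟩ ⟨ψ, hψ, hv, hG⟩ ⟨ψ', hψ', hv', hG'⟩
    refine ⟨ψ + ψ', hψ.add hψ', (Lp.coeFn_add _ _).trans (hv.add hv'),
      (Lp.coeFn_add _ _).trans ((hG.add hG').trans (.of_forall fun x => ?_))⟩
    simp only [gradient, Pi.add_apply]
    rw [fderiv_add (hψ.1.differentiable (by simp) x) (hψ'.1.differentiable (by simp) x), map_add]
  zero_mem' := by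
    refine ⟨0, ⟨contDiff_const, HasCompactSupport.zero, by simp⟩, Lp.coeFn_zero _ _ _,
      (Lp.coeFn_zero _ _ _).trans (.of_forall fun x => ?_)⟩
    simp [gradient]
  smul_mem' := by
    rintro a ⟨v, G⟩ ⟨ψ, hψ, hv, hG⟩
    refine ⟨a • ψ, hψ.const_smul a, (Lp.coeFn_smul _ _).trans (hv.const_smul a),
      (Lp.coeFn_smul _ _).trans ((hG.const_smul a).trans (.of_forall fun x => ?_))⟩
    simp only [gradient, Pi.smul_apply]
    rw [fderiv_const_smul (hψ.1.differentiable (by simp) x), map_smul]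

theorem IsTest.isH10 {ψ : R3 → ℝ} (h : IsTest Ω ψ) :
    IsH10 Ω h.memLp.toLp (memLp_gradient h.1 h.2.1).toLp :=
  subset_closure ⟨ψ, h, h.memLp.coeFn_toLp, (memLp_gradient h.1 h.2.1).coeFn_toLp⟩

/-- The sum of two elements of `𝓗`. -/
def HSpace.add [IsFiniteMeasure (surf Ω)] (v w : HSpace Ω) : HSpace Ω where
  val := v.val + w.val
  grad := v.grad + w.grad
  lap := v.lap + w.lap
  normalDeriv := v.normalDeriv + w.normalDeriv
  isH10 := (testPairs Ω).topologicalClosure.add_mem v.isH10 w.isH10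
  hasWeakDiv := hasWeakDiv_iff.2 fun ψ h => by
    rw [inner_add_left, inner_add_left, hasWeakDiv_iff.1 v.hasWeakDiv ψ h,
      hasWeakDiv_iff.1 w.hasWeakDiv ψ h, neg_add]
  hasNormalTrace := hasNormalTrace_iff.2 fun ψ h hc => by
    rw [inner_add_left, inner_add_left, inner_add_left,
      ← hasNormalTrace_iff.1 v.hasNormalTrace ψ h hc,
      ← hasNormalTrace_iff.1 w.hasNormalTrace ψ h hc, add_add_add_comm]

/-- A scalar multiple of an element of `𝓗`. -/
def HSpace.smul [IsFiniteMeasure (surf Ω)] (a : ℝ) (v : HSpace Ω) : HSpace Ω where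
  val := a • v.val
  grad := a • v.grad
  lap := a • v.lap
  normalDeriv := a • v.normalDeriv
  isH10 := (testPairs Ω).topologicalClosure.smul_mem a v.isH10
  hasWeakDiv := hasWeakDiv_iff.2 fun ψ h => by
    rw [real_inner_smul_left, real_inner_smul_left, hasWeakDiv_iff.1 v.hasWeakDiv ψ h, mul_neg]
  hasNormalTrace := hasNormalTrace_iff.2 fun ψ h hc => by
    rw [real_inner_smul_left, real_inner_smul_left, real_inner_smul_left,
      ← hasNormalTrace_iff.1 v.hasNormalTrace ψ h hc, mul_add]

theorem HSpace.norm_normalDeriv_le (v : HSpace Ω) : ‖v.normalDeriv‖ ≤ v.hnorm :=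
  Real.le_sqrt_of_sq_le (le_add_of_nonneg_left (by positivity))

theorem HSpace.isWeakPoisson (v : HSpace Ω) : IsWeakPoisson Ω (-v.lap) v := by
  rw [isWeakPoisson_iff]
  intro w G h
  have hclosed : IsClosed {p : L2 Ω × X Ω | inner ℝ v.grad p.2 = inner ℝ (-v.lap) p.1} :=
    isClosed_eq (by fun_prop) (by fun_prop)
  refine closure_minimal ?_ hclosed h
  rintro ⟨w, G⟩ ⟨ψ, hψ, hw : w =ᵐ[vol Ω] ψ, hG : G =ᵐ[vol Ω] gradient ψ⟩
  obtain rfl : w = hψ.memLp.toLp := Lp.ext (hw.trans (MemLp.coeFn_toLp _).symm)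
  obtain rfl : G = (memLp_gradient hψ.1 hψ.2.1).toLp := Lp.ext (hG.trans (MemLp.coeFn_toLp _).symm)
  rw [mem_ofPred_eq, hasWeakDiv_iff.1 v.hasWeakDiv ψ hψ, inner_neg_left]

theorem IsWeakPoisson.add [IsFiniteMeasure (surf Ω)] {g g' : L2 Ω} {w w' : HSpace Ω}
    (h : IsWeakPoisson Ω g w) (h' : IsWeakPoisson Ω g' w') :
    IsWeakPoisson Ω (g + g') (w.add w') := by
  rw [isWeakPoisson_iff] at *
  intro v G hv
  rw [HSpace.add, inner_add_left, inner_add_left, h v G hv, h' v G hv]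

theorem IsWeakPoisson.smul [IsFiniteMeasure (surf Ω)] {g : L2 Ω} {w : HSpace Ω} (a : ℝ)
    (h : IsWeakPoisson Ω g w) : IsWeakPoisson Ω (a • g) (w.smul a) := by
  rw [isWeakPoisson_iff] at *
  intro v G hv
  rw [HSpace.smul, real_inner_smul_left, real_inner_smul_left, h v G hv]

theorem IsWeakPoisson.lap_eq (hΩ : IsOpen Ω) {g : L2 Ω} {w : HSpace Ω}
    (h : IsWeakPoisson Ω g w) : w.lap = -g := by
  rw [← add_eq_zero_iff_eq_neg]
  refine eq_zero_of_integral_mul_test hΩ _ fun ψ hψ => ?_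
  rw [integral_mul_eq_inner_toLp _ hψ.memLp, inner_add_left,
    ← isWeakPoisson_iff.1 h _ _ hψ.isH10, hasWeakDiv_iff.1 w.hasWeakDiv ψ hψ, add_neg_cancel]

/-- The weak solution in `𝓗` of the homogeneous Dirichlet problem with right-hand side `g`. -/
def PoissonRegular.solution (hreg : PoissonRegular Ω) (g : L2 Ω) : HSpace Ω :=
  (hreg.choose_spec.2 g).1.choose

theorem PoissonRegular.isWeakPoisson_iff (hreg : PoissonRegular Ω) {g : L2 Ω} {w : HSpace Ω} :
    IsWeakPoisson Ω g w ↔ w = hreg.solution g :=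
  have hspec := (hreg.choose_spec.2 g).1.choose_spec
  ⟨hspec.2 w, fun h => h ▸ hspec.1⟩

/-- The operator that maps the right-hand side `g` to the normal derivative of the weak solution of
the homogeneous Dirichlet problem. -/
def PoissonRegular.normalDeriv [IsFiniteMeasure (surf Ω)] (hreg : PoissonRegular Ω) :
    L2 Ω →L[ℝ] L2Γ Ω :=
  LinearMap.mkContinuous
    { toFun g := (hreg.solution g).normalDeriv
      map_add' g g' := by
        rw [← hreg.isWeakPoisson_iff.1
          ((hreg.isWeakPoisson_iff.2 rfl).add (hreg.isWeakPoisson_iff.2 rfl))]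
        rfl
      map_smul' a g := by
        rw [← hreg.isWeakPoisson_iff.1 ((hreg.isWeakPoisson_iff.2 rfl).smul a)]
        rfl }
    hreg.choose fun g => (HSpace.norm_normalDeriv_le _).trans
      ((hreg.choose_spec.2 g).2 _ (hreg.isWeakPoisson_iff.2 rfl))

/-- The very weak solution operator, by duality. -/
def PoissonRegular.veryWeakSolution [IsFiniteMeasure (surf Ω)] (hreg : PoissonRegular Ω) :
    L2Γ Ω →L[ℝ] L2 Ω :=
  -ContinuousLinearMap.adjoint hreg.normalDeriv

theorem PoissonRegular.isVeryWeakSolution_iff [IsFiniteMeasure (surf Ω)] (hΩ : IsOpen Ω)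
    (hreg : PoissonRegular Ω) {u : L2Γ Ω} {η : L2 Ω} :
    IsVeryWeakSolution Ω u η ↔ η = hreg.veryWeakSolution u := by
  have hdual : IsVeryWeakSolution Ω u η ↔
      ∀ g : L2 Ω, inner ℝ (η + ContinuousLinearMap.adjoint hreg.normalDeriv u) g = 0 := by
    simp_rw [Abraham.isVeryWeakSolution_iff, inner_add_left,
      ContinuousLinearMap.adjoint_inner_left]
    refine ⟨fun h g => ?_, fun h v => ?_⟩
    · have hg := h (hreg.solution g)
      rwa [(hreg.isWeakPoisson_iff.2 rfl).lap_eq hΩ, inner_neg_right, neg_neg] at hg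
    · have hv := h (-v.lap)
      change inner ℝ η (-v.lap) + inner ℝ u (hreg.solution (-v.lap)).normalDeriv = 0 at hv
      rwa [inner_neg_right, ← hreg.isWeakPoisson_iff.1 v.isWeakPoisson] at hv
  rw [hdual, PoissonRegular.veryWeakSolution, neg_apply, ← add_eq_zero_iff_eq_neg]
  exact ⟨fun h => inner_self_eq_zero.1 (h _), fun h g => by rw [h, inner_zero_left]⟩

end VeryWeakSolution

/-! ### Measurability of the outward normal -/

section Normal

theorem measurableSet_image_fst {α β : Type*} [MeasurableSpace α] [StandardBorelSpace α]
    [MeasurableSpace β] [StandardBorelSpace β] {S : Set (α × β)} (hS : MeasurableSet S)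
    (hinj : InjOn Prod.fst S) : MeasurableSet (Prod.fst '' S) :=
  hS.image_of_measurable_injOn measurable_fst hinj

theorem measurable_of_measurableSet_graph {α β : Type*} [MeasurableSpace α] [StandardBorelSpace α]
    [MeasurableSpace β] [StandardBorelSpace β] {f : α → β}
    (hf : MeasurableSet {p : α × β | p.2 = f p.1}) : Measurable f := by
  intro A hA
  have himage : f ⁻¹' A = Prod.fst '' ({p : α × β | p.2 = f p.1} ∩ Prod.snd ⁻¹' A) := by
    ext x
    simp
  rw [himage]
  refine measurableSet_image_fst (hf.inter (measurable_snd hA)) ?_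
  rintro ⟨x, y⟩ ⟨rfl : y = f x, -⟩ ⟨x', y'⟩ ⟨rfl : y' = f x', -⟩ rfl
  rfl

variable {Ω : Set R3}

theorem IsOutwardUnitNormal.eventually_add_smul {x ν : R3} (h : IsOutwardUnitNormal Ω x ν) {ε : ℝ}
    (hε : 0 < ε) (d : R3) : ∀ᶠ s : ℝ in 𝓝[>] 0,
      (inner ℝ d ν < -ε * ‖d‖ → x + s • d ∈ Ω) ∧ (ε * ‖d‖ < inner ℝ d ν → x + s • d ∉ Ω) := by
  obtain ⟨δ, hδ, hball⟩ := h.2 ε hε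
  have hnear : ∀ᶠ s : ℝ in 𝓝[>] 0, dist (x + s • d) x < δ := by
    have hcont : Continuous fun s : ℝ => dist (x + s • d) x := by fun_prop
    exact (hcont.tendsto' 0 0 (by simp)).mono_left nhdsWithin_le_nhds (gt_mem_nhds hδ)
  filter_upwards [hnear, self_mem_nhdsWithin] with s hs (hs0 : 0 < s)
  obtain ⟨hin, hout⟩ := hball _ hs
  rw [add_sub_cancel_left, norm_smul, Real.norm_of_nonneg hs0.le, real_inner_smul_left,
    mul_left_comm, mul_lt_mul_iff_right₀ hs0] at hin hout
  exact ⟨hin, hout⟩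

theorem IsOutwardUnitNormal.unique {x ν ν' : R3} (h : IsOutwardUnitNormal Ω x ν)
    (h' : IsOutwardUnitNormal Ω x ν') : ν = ν' := by
  by_contra hne
  have hlt : inner ℝ ν' ν < 1 := (inner_lt_one_iff_real_of_norm_eq_one h'.1 h.1).2 (Ne.symm hne)
  obtain ⟨ε, hε, hsmall⟩ := exists_pos_mul_lt (sub_pos.2 hlt) ‖ν' - ν‖
  have hneg : inner ℝ (ν' - ν) ν < -ε * ‖ν' - ν‖ := by
    rw [inner_sub_left, real_inner_self_eq_norm_sq, h.1]
    linarith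
  have hpos : ε * ‖ν' - ν‖ < inner ℝ (ν' - ν) ν' := by
    rw [inner_sub_left, real_inner_self_eq_norm_sq, h'.1, real_inner_comm]
    linarith
  obtain ⟨s, hin, hout⟩ :=
    ((h.eventually_add_smul hε (ν' - ν)).and (h'.eventually_add_smul hε (ν' - ν))).exists
  exact hout.2 hpos (hin.1 hneg)

/-- The pairs `(x, ν)` such that, in the ball with radius `δ` around `x`, the set `Ω` differs from
the half-space with outward normal `ν` only inside a cone whose opening is controlled by `ε`. -/
def nearNormal (Ω : Set R3) (ε δ : ℝ) : Set (R3 × R3) :=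
  {p | ∀ y : R3, dist y p.1 < δ → (inner ℝ (y - p.1) p.2 < -ε * ‖y - p.1‖ → y ∈ Ω) ∧
    (ε * ‖y - p.1‖ < inner ℝ (y - p.1) p.2 → y ∉ Ω)}

theorem isClosed_nearNormal (Ω : Set R3) (ε δ : ℝ) : IsClosed (nearNormal Ω ε δ) := by
  rw [nearNormal, ofPred_forall]
  exact isClosed_iInter fun y => isClosed_imp (isOpen_lt (by fun_prop) (by fun_prop)) <|
    (isClosed_imp (isOpen_lt (by fun_prop) (by fun_prop)) isClosed_const).and
      (isClosed_imp (isOpen_lt (by fun_prop) (by fun_prop)) isClosed_const)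

theorem nearNormal_mono {ε ε' δ δ' : ℝ} (hε : ε ≤ ε') (hδ : δ' ≤ δ) :
    nearNormal Ω ε δ ⊆ nearNormal Ω ε' δ' := by
  intro p hp y hy
  have hball := hp y (hy.trans_le hδ)
  have hcone := mul_le_mul_of_nonneg_right hε (norm_nonneg (y - p.1))
  exact ⟨fun hin => hball.1 (by linarith), fun hout => hball.2 (by linarith)⟩

theorem measurableSet_isOutwardUnitNormal (Ω : Set R3) :
    MeasurableSet {p : R3 × R3 | IsOutwardUnitNormal Ω p.1 p.2} := by
  have hcountable : {p : R3 × R3 | IsOutwardUnitNormal Ω p.1 p.2} = {p | ‖p.2‖ = 1} ∩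
      ⋂ k : ℕ, ⋃ n : ℕ, nearNormal Ω (1 / (k + 1)) (1 / (n + 1)) := by
    ext p
    simp only [mem_inter_iff, mem_iInter, mem_iUnion, mem_ofPred_eq, IsOutwardUnitNormal]
    refine and_congr_right fun _ => ⟨fun h k => ?_, fun h ε hε => ?_⟩
    · obtain ⟨δ, hδ, hball⟩ := h (1 / (k + 1)) (by positivity)
      obtain ⟨n, hn⟩ := exists_nat_one_div_lt hδ
      exact ⟨n, nearNormal_mono le_rfl hn.le hball⟩
    · obtain ⟨k, hk⟩ := exists_nat_one_div_lt hε
      obtain ⟨n, hn⟩ := h k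
      exact ⟨_, by positivity, nearNormal_mono hk.le le_rfl hn⟩
  rw [hcountable]
  refine (isClosed_eq (by fun_prop) continuous_const).measurableSet.inter ?_
  exact .iInter fun k => .iUnion fun n => (isClosed_nearNormal Ω _ _).measurableSet

theorem IsOutwardUnitNormal.outwardNormal_eq {x ν : R3} (h : IsOutwardUnitNormal Ω x ν) :
    outwardNormal Ω x = ν := by
  have hex : ∃ ν, IsOutwardUnitNormal Ω x ν := ⟨ν, h⟩
  rw [outwardNormal, dif_pos hex]
  exact hex.choose_spec.unique h

theorem norm_outwardNormal_le (Ω : Set R3) (x : R3) : ‖outwardNormal Ω x‖ ≤ 1 := by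
  by_cases h : ∃ ν, IsOutwardUnitNormal Ω x ν
  · obtain ⟨ν, hν⟩ := h
    rw [hν.outwardNormal_eq, hν.1]
  · rw [outwardNormal, dif_neg h, norm_zero]
    exact zero_le_one

theorem measurable_outwardNormal (Ω : Set R3) : Measurable (outwardNormal Ω) := by
  refine measurable_of_measurableSet_graph ?_
  have hN := measurableSet_isOutwardUnitNormal Ω
  have hgraph : {p : R3 × R3 | p.2 = outwardNormal Ω p.1} =
      {p | IsOutwardUnitNormal Ω p.1 p.2} ∪
        (Prod.fst '' {p : R3 × R3 | IsOutwardUnitNormal Ω p.1 p.2})ᶜ ×ˢ {0} := by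
    ext ⟨x, ν⟩
    simp only [mem_ofPred_eq, mem_union, mem_prod, mem_compl_iff, mem_image, Prod.exists,
      exists_and_right, exists_eq_right, mem_singleton_iff]
    by_cases h : ∃ ν, IsOutwardUnitNormal Ω x ν
    · obtain ⟨ν', hν'⟩ := h
      rw [hν'.outwardNormal_eq]
      exact ⟨fun hν => .inl (hν ▸ hν'),
        fun hν => hν.elim (·.unique hν') fun hν => absurd ⟨ν', hν'⟩ hν.1⟩
    · rw [outwardNormal, dif_neg h]
      exact ⟨fun hν => .inr ⟨h, hν⟩, fun hν => hν.elim (fun hν => absurd ⟨ν, hν⟩ h) And.right⟩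
  rw [hgraph]
  refine hN.union ((measurableSet_image_fst hN ?_).compl.prod (measurableSet_singleton 0))
  rintro ⟨x, ν⟩ h ⟨x', ν'⟩ h' rfl
  exact Prod.ext rfl (h.unique h')

end Normal

/-! ### Causal evolution equations -/

section Volterra

variable {E : Type*} [NormedAddCommGroup E] {T L : ℝ} {Φ : (ℝ → E) → ℝ → E}

/-- A causal (Volterra) operator: it preserves continuity, and the value of `Φ y` at `t ∈ [0,T]`
depends Lipschitz continuously, with constant `L`, on the restriction of `y` to `[0,t]`. -/
structure IsCausal (T L : ℝ) (Φ : (ℝ → E) → ℝ → E) : Prop where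
  nonneg : 0 ≤ L
  continuous : ∀ y, Continuous y → Continuous (Φ y)
  lipschitz : ∀ y y', ContinuousOn y (Icc 0 T) → ContinuousOn y' (Icc 0 T) → ∀ t ∈ Icc 0 T,
    ∀ b : ℝ, (∀ s ∈ Icc 0 t, ‖y s - y' s‖ ≤ b) → ‖Φ y t - Φ y' t‖ ≤ L * b

theorem IsCausal.eqOn (hΦ : IsCausal T L Φ) {y y' : ℝ → E}
    (hy : ContinuousOn y (Icc 0 T)) (h : EqOn y y' (Icc 0 T)) : EqOn (Φ y) (Φ y') (Icc 0 T) := by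
  intro t ht
  have hdiff := hΦ.lipschitz y y' hy (hy.congr h.symm) t ht 0 fun s hs => by
    rw [h ⟨hs.1, hs.2.trans ht.2⟩, sub_self, norm_zero]
  rw [mul_zero] at hdiff
  exact sub_eq_zero.1 (norm_le_zero_iff.1 hdiff)

variable [NormedSpace ℝ E]

theorem IsCausal.norm_integral_sub_le (hΦ : IsCausal T L Φ) {y y' : ℝ → E} (hy : Continuous y)
    (hy' : Continuous y') {C : ℝ} (hC : 0 ≤ C) {n : ℕ}
    (h : ∀ s ∈ Icc 0 T, ‖y s - y' s‖ ≤ C * s ^ n) {t : ℝ} (ht : t ∈ Icc 0 T) :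
    ‖(∫ s in (0 : ℝ)..t, Φ y s) - ∫ s in (0 : ℝ)..t, Φ y' s‖ ≤
      L * C / (n + 1) * t ^ (n + 1) := by
  have hbound : ∀ s ∈ Ioc 0 t, ‖Φ y s - Φ y' s‖ ≤ L * C * s ^ n := by
    intro s hs
    have hsT : s ∈ Icc 0 T := ⟨hs.1.le, hs.2.trans ht.2⟩
    rw [mul_assoc]
    refine hΦ.lipschitz y y' hy.continuousOn hy'.continuousOn s hsT _ fun τ hτ =>
      (h τ ⟨hτ.1, hτ.2.trans hsT.2⟩).trans ?_
    have hτ0 := hτ.1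
    have hτs := hτ.2
    gcongr
  rw [← intervalIntegral.integral_sub ((hΦ.continuous y hy).intervalIntegrable _ _)
    ((hΦ.continuous y' hy').intervalIntegrable _ _)]
  refine (intervalIntegral.norm_integral_le_of_norm_le ht.1 (.of_forall hbound)
    (Continuous.intervalIntegrable (by fun_prop) _ _)).trans_eq ?_
  rw [intervalIntegral.integral_const_mul, integral_pow, zero_pow n.succ_ne_zero]
  ring

/-- The Picard operator `y ↦ ∫₀ Φ y`. -/
def IsCausal.picard (hΦ : IsCausal T L Φ) (hT : 0 ≤ T) (y : C(Icc 0 T, E)) : C(Icc 0 T, E) where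
  toFun t := ∫ s in (0 : ℝ)..t, Φ (IccExtend hT y) s
  continuous_toFun :=
    (intervalIntegral.continuous_primitive
      (fun _ _ => (hΦ.continuous _ y.continuous.Icc_extend').intervalIntegrable _ _) 0).comp
      continuous_subtype_val

theorem IsCausal.norm_iterate_picard_sub_le (hΦ : IsCausal T L Φ) (hT : 0 ≤ T)
    (y y' : C(Icc 0 T, E)) (n : ℕ) (t : Icc 0 T) :
    ‖(hΦ.picard hT)^[n] y t - (hΦ.picard hT)^[n] y' t‖ ≤
      L ^ n / n.factorial * dist y y' * (t : ℝ) ^ n := by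
  induction n generalizing t with
  | zero => simpa [dist_eq_norm] using ContinuousMap.dist_apply_le_dist (f := y) (g := y') t
  | succ n ih =>
    have hL := hΦ.nonneg
    rw [Function.iterate_succ_apply', Function.iterate_succ_apply']
    refine (hΦ.norm_integral_sub_le (C := L ^ n / n.factorial * dist y y') (n := n)
      (ContinuousMap.continuous _).Icc_extend' (ContinuousMap.continuous _).Icc_extend'
      (by positivity) (fun s hs => ?_) t.2).trans_eq ?_
    · rw [IccExtend_of_mem hT _ hs, IccExtend_of_mem hT _ hs]
      exact ih ⟨s, hs⟩
    · rw [Nat.factorial_succ]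
      push_cast
      field_simp
      ring

theorem IsCausal.exists_contractingWith (hΦ : IsCausal T L Φ) (hT : 0 ≤ T) :
    ∃ n : ℕ, ∃ K, ContractingWith K (hΦ.picard hT)^[n] := by
  have hL := hΦ.nonneg
  obtain ⟨n, hn⟩ := ((FloorSemiring.tendsto_pow_div_factorial_atTop (L * T)).eventually
    (gt_mem_nhds one_half_pos)).exists
  refine ⟨n, 1 / 2, by norm_num, LipschitzWith.of_dist_le_mul fun y y' =>
    (ContinuousMap.dist_le (by positivity)).2 fun t => ?_⟩
  have ht : (t : ℝ) ^ n ≤ T ^ n := pow_le_pow_left₀ t.2.1 t.2.2 n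
  calc dist ((hΦ.picard hT)^[n] y t) ((hΦ.picard hT)^[n] y' t)
      ≤ L ^ n / n.factorial * dist y y' * (t : ℝ) ^ n := by
        rw [dist_eq_norm]
        exact hΦ.norm_iterate_picard_sub_le hT y y' n t
    _ ≤ L ^ n / n.factorial * dist y y' * T ^ n := by gcongr
    _ = (L * T) ^ n / n.factorial * dist y y' := by ring
    _ ≤ 1 / 2 * dist y y' := mul_le_mul_of_nonneg_right hn.le dist_nonneg

/-- `y` is a continuously differentiable solution of `y' = Φ y`, `y(0) = 0`, on `[0,T]`. -/
structure IsVolterraSolution (T : ℝ) (Φ : (ℝ → E) → ℝ → E) (y : ℝ → E) : Prop where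
  contDiffOn : ContDiffOn ℝ 1 y (Icc 0 T)
  map_zero : y 0 = 0
  derivWithin_eq : EqOn (derivWithin y (Icc 0 T)) (Φ y) (Icc 0 T)

variable [CompleteSpace E]

theorem IsVolterraSolution.eq_integral {y : ℝ → E} (hy : IsVolterraSolution T Φ y) {t : ℝ}
    (ht : t ∈ Icc 0 T) : y t = ∫ s in (0 : ℝ)..t, Φ y s := by
  have hFTC := intervalIntegral.integral_deriv_of_contDiffOn_Icc
    (hy.contDiffOn.mono (Icc_subset_Icc_right ht.2)) ht.1
  rw [hy.map_zero, sub_zero] at hFTC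
  refine hFTC.symm.trans (intervalIntegral.integral_congr_Ioo_of_le ht.1 fun s hs => ?_)
  have hsT : s ∈ Ioo 0 T := ⟨hs.1, hs.2.trans_le ht.2⟩
  rw [← hy.derivWithin_eq (Ioo_subset_Icc_self hsT),
    derivWithin_of_mem_nhds (Icc_mem_nhds hsT.1 hsT.2)]

theorem IsCausal.isFixedPt_picard (hΦ : IsCausal T L Φ) (hT : 0 ≤ T) {y : ℝ → E}
    (hy : IsVolterraSolution T Φ y) :
    Function.IsFixedPt (hΦ.picard hT)
      ⟨fun t : Icc 0 T => y t, hy.contDiffOn.continuousOn.domRestrict⟩ := by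
  ext t
  refine (intervalIntegral.integral_congr fun s hs => ?_).trans (hy.eq_integral t.2).symm
  rw [uIcc_of_le t.2.1] at hs
  exact (hΦ.eqOn hy.contDiffOn.continuousOn (fun τ hτ => by rw [IccExtend_of_mem hT _ hτ]; rfl)
    ⟨hs.1, hs.2.trans t.2.2⟩).symm

theorem IsCausal.eqOn_of_isVolterraSolution (hΦ : IsCausal T L Φ) (hT : 0 ≤ T) {y y' : ℝ → E}
    (hy : IsVolterraSolution T Φ y) (hy' : IsVolterraSolution T Φ y') : EqOn y y' (Icc 0 T) := by
  obtain ⟨n, K, hK⟩ := hΦ.exists_contractingWith hT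
  have heq := hK.fixedPoint_unique' ((hΦ.isFixedPt_picard hT hy).iterate n)
    ((hΦ.isFixedPt_picard hT hy').iterate n)
  exact fun t ht => DFunLike.congr_fun heq ⟨t, ht⟩

theorem IsCausal.exists_isVolterraSolution (hΦ : IsCausal T L Φ) (hT : 0 < T) :
    ∃ y, IsVolterraSolution T Φ y := by
  obtain ⟨n, K, hK⟩ := hΦ.exists_contractingWith hT.le
  have hfix := hK.isFixedPt_fixedPoint_iterate
  set y := ContractingWith.fixedPoint (hΦ.picard hT.le)^[n] hK
  set f : ℝ → E := Φ (IccExtend hT.le y)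
  have hf : Continuous f := hΦ.continuous _ y.continuous.Icc_extend'
  have hderiv (t : ℝ) : HasDerivAt (fun t => ∫ s in (0 : ℝ)..t, f s) (f t) t :=
    intervalIntegral.integral_hasDerivAt_right (hf.intervalIntegrable _ _)
      (hf.stronglyMeasurableAtFilter _ _) hf.continuousAt
  have heq : EqOn (IccExtend hT.le y) (fun t => ∫ s in (0 : ℝ)..t, f s) (Icc 0 T) := fun t ht =>
    (IccExtend_of_mem hT.le _ ht).trans (DFunLike.congr_fun hfix ⟨t, ht⟩).symm
  refine ⟨_, ContDiff.contDiffOn (contDiff_one_iff_deriv.2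
    ⟨fun t => (hderiv t).differentiableAt, ?_⟩), intervalIntegral.integral_same, fun t ht => ?_⟩
  · rwa [funext fun t => (hderiv t).deriv]
  · rw [(hderiv t).hasDerivWithinAt.derivWithin (uniqueDiffOn_Icc hT t ht)]
    exact hΦ.eqOn y.continuous.Icc_extend'.continuousOn heq ht

end Volterra

/-! ### The Lorentz force as a function of the state -/

section BoundedLipschitz

variable {P Q E F G : Type*} [PseudoMetricSpace P] [PseudoMetricSpace Q]
  [NormedAddCommGroup E] [NormedAddCommGroup F] [NormedAddCommGroup G]

/-- Bounded Lipschitz continuous functions. They are stable under products, so the smeared current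
and the Lorentz force inherit the property from the charge density and the velocity. -/
structure IsBoundedLipschitz (f : P → E) : Prop where
  bounded : ∃ C, ∀ x, ‖f x‖ ≤ C
  lipschitz : ∃ K, LipschitzWith K f

theorem IsBoundedLipschitz.of_norm_le {f : P → E} {C K : ℝ} (hC : ∀ x, ‖f x‖ ≤ C)
    (hK : ∀ x y, ‖f x - f y‖ ≤ K * dist x y) : IsBoundedLipschitz f :=
  ⟨⟨C, hC⟩, K.toNNReal, .of_dist_le' fun x y => (dist_eq_norm _ _).trans_le (hK x y)⟩

theorem IsBoundedLipschitz.exists_bound {f : P → E} (hf : IsBoundedLipschitz f) :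
    ∃ C, 0 ≤ C ∧ (∀ x, ‖f x‖ ≤ C) ∧ ∀ x y, ‖f x - f y‖ ≤ C * dist x y := by
  obtain ⟨C, hC⟩ := hf.bounded
  obtain ⟨K, hK⟩ := hf.lipschitz
  refine ⟨max C K, K.2.trans (le_max_right _ _), fun x => (hC x).trans (le_max_left _ _),
    fun x y => ?_⟩
  rw [← dist_eq_norm]
  exact (hK.dist_le_mul x y).trans (by gcongr; exact le_max_right _ _)

theorem IsBoundedLipschitz.continuous {f : P → E} (hf : IsBoundedLipschitz f) : Continuous f :=
  hf.lipschitz.choose_spec.continuous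

theorem IsBoundedLipschitz.comp {f : Q → E} (hf : IsBoundedLipschitz f) {g : P → Q} {K : NNReal}
    (hg : LipschitzWith K g) : IsBoundedLipschitz (f ∘ g) :=
  ⟨hf.bounded.imp fun _ hC x => hC (g x), _, hf.lipschitz.choose_spec.comp hg⟩

theorem IsBoundedLipschitz.add {f g : P → E} (hf : IsBoundedLipschitz f)
    (hg : IsBoundedLipschitz g) : IsBoundedLipschitz fun x => f x + g x :=
  ⟨⟨_, fun x => norm_add_le_of_le (hf.bounded.choose_spec x) (hg.bounded.choose_spec x)⟩,
    _, hf.lipschitz.choose_spec.add hg.lipschitz.choose_spec⟩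

theorem isBoundedLipschitz_const (a : E) : IsBoundedLipschitz fun _ : P => a :=
  ⟨⟨_, fun _ => le_rfl⟩, 0, .const a⟩

theorem IsBoundedLipschitz.of_contDiff [NormedSpace ℝ E] {f : F → E} [NormedSpace ℝ F]
    (hf : ContDiff ℝ 1 f) (hc : HasCompactSupport f) : IsBoundedLipschitz f :=
  ⟨hf.continuous.bounded_above_of_compact_support hc,
    hf.lipschitzWith_of_hasCompactSupport hc one_ne_zero⟩

variable [NormedSpace ℝ E] [NormedSpace ℝ F] [NormedSpace ℝ G]

theorem IsBoundedLipschitz.bilin {f : P → E} {g : P → F} (B : E →L[ℝ] F →L[ℝ] G)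
    (hf : IsBoundedLipschitz f) (hg : IsBoundedLipschitz g) :
    IsBoundedLipschitz fun x => B (f x) (g x) := by
  obtain ⟨C, hC, hfC, hfL⟩ := hf.exists_bound
  obtain ⟨D, _, hgD, hgL⟩ := hg.exists_bound
  refine .of_norm_le (C := ‖B‖ * C * D) (K := ‖B‖ * C * D + ‖B‖ * C * D) (fun x => ?_)
    fun x y => ?_
  · exact (B.le_opNorm₂ _ _).trans (by gcongr; exacts [hfC x, hgD x])
  · have hsplit : B (f x) (g x) - B (f y) (g y) = B (f x - f y) (g x) + B (f y) (g x - g y) := by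
      simp only [map_sub, sub_apply, sub_add_sub_cancel]
    calc ‖B (f x) (g x) - B (f y) (g y)‖
        ≤ ‖B‖ * ‖f x - f y‖ * ‖g x‖ + ‖B‖ * ‖f y‖ * ‖g x - g y‖ := by
          rw [hsplit]
          exact norm_add_le_of_le (B.le_opNorm₂ _ _) (B.le_opNorm₂ _ _)
      _ ≤ ‖B‖ * (C * dist x y) * D + ‖B‖ * C * (D * dist x y) := by
          gcongr
          exacts [hfL x y, hgD x, hfC y, hgL x y]
      _ = (‖B‖ * C * D + ‖B‖ * C * D) * dist x y := by ring

theorem IsBoundedLipschitz.clm {f : P → E} (L : E →L[ℝ] F) (hf : IsBoundedLipschitz f) :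
    IsBoundedLipschitz fun x => L (f x) :=
  .bilin (.id ℝ (E →L[ℝ] F)) (isBoundedLipschitz_const L) hf

theorem IsBoundedLipschitz.const_smul {f : P → E} (hf : IsBoundedLipschitz f) (a : ℝ) :
    IsBoundedLipschitz fun x => a • f x :=
  hf.clm (a • ContinuousLinearMap.id ℝ E)

theorem IsBoundedLipschitz.clm_comp {f : P → F →L[ℝ] G} {g : P → E →L[ℝ] F}
    (hf : IsBoundedLipschitz f) (hg : IsBoundedLipschitz g) :
    IsBoundedLipschitz fun x => (f x).comp (g x) :=
  .bilin (ContinuousLinearMap.compL ℝ E F G) hf hg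

theorem IsBoundedLipschitz.exists_lipschitzOnWith_apply {M : P → F →L[ℝ] G}
    (hM : IsBoundedLipschitz M) (R : ℝ) :
    ∃ K, LipschitzOnWith K (fun z : P × F => M z.1 z.2) (univ ×ˢ Metric.closedBall 0 R) := by
  obtain ⟨C, hC, hMC, hML⟩ := hM.exists_bound
  refine ⟨_, .of_dist_le' (K := C * R + C) ?_⟩
  rintro ⟨p, f⟩ ⟨-, hf⟩ ⟨p', f'⟩ -
  have hfR : ‖f‖ ≤ R := mem_closedBall_zero_iff.1 hf
  rw [dist_eq_norm]
  calc ‖M p f - M p' f'‖ = ‖(M p - M p') f + M p' (f - f')‖ := by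
        rw [sub_apply, map_sub, sub_add_sub_cancel]
    _ ≤ C * dist p p' * R + C * dist f f' :=
        norm_add_le_of_le (ContinuousLinearMap.le_of_opNorm_le_of_le _ (hML p p') hfR)
          (ContinuousLinearMap.le_of_opNorm_le_of_le _ (hMC p') (dist_eq_norm f f').ge)
    _ ≤ (C * R + C) * dist (p, f) (p', f') := by
        have hR : 0 ≤ R := (norm_nonneg f).trans hfR
        rw [mul_right_comm, add_mul]
        gcongr
        exacts [le_max_left _ _, le_max_right _ _]

theorem IsBoundedLipschitz.exists_lipschitzOnWith_apply_prodMk {M : P → E × F →L[ℝ] G}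
    (hM : IsBoundedLipschitz M) (R : ℝ) (b : F) :
    ∃ K, LipschitzOnWith K (fun z : P × E => M z.1 (z.2, b)) (univ ×ˢ Metric.closedBall 0 R) := by
  obtain ⟨K, hK⟩ := hM.exists_lipschitzOnWith_apply (max R ‖b‖)
  have harg := (LipschitzWith.prod_fst (α := P) (β := E)).prodMk
    (LipschitzWith.prod_snd.prodMk (.const b))
  exact ⟨_, hK.comp harg.lipschitzOnWith fun z hz => ⟨mem_univ _, mem_closedBall_zero_iff.2
    (max_le_max (mem_closedBall_zero_iff.1 hz.2) le_rfl)⟩⟩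

end BoundedLipschitz

section Translates

variable {P E F G : Type*} [NormedAddCommGroup P] [MeasurableSpace P] [BorelSpace P]
  [NormedAddCommGroup E] {μ : Measure P}

theorem eLpNorm_translate_sub_le {f g : P → E} {R C : ℝ} {M : NNReal}
    (hM : ∀ r, μ (Metric.closedBall r R) ≤ M) (hf : Function.support f ⊆ Metric.closedBall 0 R)
    (hg : Function.support g ⊆ Metric.closedBall 0 R) (hC : 0 ≤ C) (r s : P)
    (h : ∀ x, ‖f (x - r) - g (x - s)‖ ≤ C) :
    eLpNorm (fun x => f (x - r) - g (x - s)) 2 μ ≤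
      ENNReal.ofReal C * (2 * M : ENNReal) ^ (2⁻¹ : ℝ) := by
  have hshift {f : P → E} (hf : Function.support f ⊆ Metric.closedBall 0 R) (r : P) :
      Function.support (fun x => f (x - r)) ⊆ Metric.closedBall r R := fun x hx =>
    mem_closedBall_iff_norm.2 (mem_closedBall_zero_iff.1 (hf hx))
  have hball : μ (Metric.closedBall r R ∪ Metric.closedBall s R) ≤ 2 * M :=
    (measure_union_le _ _).trans ((add_le_add (hM r) (hM s)).trans_eq (two_mul _).symm)
  refine (eLpNorm_sub_le_of_dist_bdd μ ENNReal.ofNat_ne_top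
    (measurableSet_closedBall.union measurableSet_closedBall) hC
    (fun x => (dist_eq_norm _ _).trans_le (h x)) ((hshift hf r).trans subset_union_left)
    ((hshift hg s).trans subset_union_right)).trans ?_
  rw [ENNReal.toReal_ofNat, one_div]
  gcongr

variable [SecondCountableTopology P]

theorem exists_translates (hμ : ∀ R, ∃ M : NNReal, ∀ r, μ (Metric.closedBall r R) ≤ M)
    {f : P → E} (hf : IsBoundedLipschitz f) (hc : HasCompactSupport f) :
    ∃ κ : P → Lp E 2 μ, (∀ r, κ r =ᵐ[μ] fun x => f (x - r)) ∧ IsBoundedLipschitz κ := by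
  obtain ⟨C, hC, hbound, hlip⟩ := hf.exists_bound
  obtain ⟨R, hR⟩ := hc.isCompact.isBounded.subset_closedBall 0
  obtain ⟨M, hM⟩ := hμ R
  have hsupp : Function.support f ⊆ Metric.closedBall 0 R := (subset_tsupport f).trans hR
  set a := (2 * M : ENNReal) ^ (2⁻¹ : ℝ) with ha_def
  have ha : a ≠ ⊤ := by finiteness
  have hle (r : P) : eLpNorm (fun x => f (x - r)) 2 μ ≤ ENNReal.ofReal C * a := by
    simpa using eLpNorm_translate_sub_le (g := 0) hM hsupp (by simp) hC r r
      (by simpa using fun x => hbound (x - r))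
  have hmem (r : P) : MemLp (fun x => f (x - r)) 2 μ :=
    ⟨(hf.continuous.comp (by fun_prop)).aestronglyMeasurable, (hle r).trans_lt (by finiteness)⟩
  refine ⟨fun r => (hmem r).toLp, fun r => (hmem r).coeFn_toLp,
    .of_norm_le (C := C * a.toReal) (K := C * a.toReal) (fun r => ?_) fun r s => ?_⟩
  · rw [Lp.norm_toLp]
    refine ENNReal.toReal_le_of_le_ofReal (by positivity) ((hle r).trans_eq ?_)
    rw [ENNReal.ofReal_mul hC, ENNReal.ofReal_toReal ha]
  · rw [← MemLp.toLp_sub, Lp.norm_toLp]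
    refine ENNReal.toReal_le_of_le_ofReal (by positivity)
      ((eLpNorm_translate_sub_le (C := C * dist r s) hM hsupp hsupp (by positivity) r s
        fun x => ?_).trans_eq ?_)
    · exact (hlip _ _).trans_eq (by rw [dist_sub_left])
    · rw [← ha_def, mul_right_comm, ENNReal.ofReal_mul (by positivity : 0 ≤ C * dist r s),
        ENNReal.ofReal_toReal ha]

variable [NormedSpace ℝ E] [NormedAddCommGroup F] [NormedSpace ℝ F] [NormedAddCommGroup G]
  [NormedSpace ℝ G] [CompleteSpace G]

theorem exists_integral_translate (hμ : ∀ R, ∃ M : NNReal, ∀ r, μ (Metric.closedBall r R) ≤ M)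
    {f : P → E} (hf : IsBoundedLipschitz f) (hc : HasCompactSupport f) (B : E →L[ℝ] F →L[ℝ] G) :
    ∃ K : P → Lp F 2 μ →L[ℝ] G, IsBoundedLipschitz K ∧
      ∀ r g, Integrable (fun x => B (f (x - r)) (g x)) μ ∧
        K r g = ∫ x, B (f (x - r)) (g x) ∂μ := by
  obtain ⟨κ, hκ, hκL⟩ := exists_translates hμ hf hc
  have hae (r : P) (g : Lp F 2 μ) :
      (fun x => B (κ r x) (g x)) =ᵐ[μ] fun x => B (f (x - r)) (g x) := by
    filter_upwards [hκ r] with x hx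
    rw [hx]
  refine ⟨fun r => B.lpPairing μ 2 2 (κ r), hκL.clm _, fun r g => ⟨?_, ?_⟩⟩
  · exact (integrable_congr (hae r g)).1
      (memLp_one_iff_integrable.1 (B.memLp_of_bilin 1 (Lp.memLp (κ r)) (Lp.memLp g)))
  · rw [ContinuousLinearMap.lpPairing_eq_integral, integral_congr_ae (hae r g)]

end Translates

section Velocity

variable {V : Type*} [NormedAddCommGroup V] [NormedSpace ℝ V]

theorem norm_normalize_sub_le {x y : V} (hx : 1 ≤ ‖x‖) (hy : y ≠ 0) :
    ‖NormedSpace.normalize x - NormedSpace.normalize y‖ ≤ 2 * ‖x - y‖ := by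
  have hsplit : NormedSpace.normalize x - NormedSpace.normalize y =
      ‖x‖⁻¹ • ((x - y) + (‖y‖ - ‖x‖) • NormedSpace.normalize y) := by
    rw [sub_smul, NormedSpace.norm_smul_normalize, sub_add_sub_cancel, smul_sub,
      inv_smul_smul₀ (by positivity), NormedSpace.normalize]
  rw [hsplit, norm_smul, norm_inv, norm_norm, two_mul]
  refine (mul_le_of_le_one_left (norm_nonneg _) (inv_le_one_of_one_le₀ hx)).trans
    (norm_add_le_of_le le_rfl ?_)
  rw [norm_smul, NormedSpace.norm_normalize_eq_one_iff.2 hy, mul_one, norm_sub_rev]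
  exact abs_norm_sub_norm_le x y

variable {m c : ℝ}

/-- The vector `(1, p / (m c))` of the mass hyperboloid; its Euclidean norm is the Lorentz
factor. -/
def fourMomentum (m c : ℝ) (p : R3) : WithLp 2 (ℝ × R3) := WithLp.toLp 2 (1, (m * c)⁻¹ • p)

theorem norm_fourMomentum (m c : ℝ) (p : R3) : ‖fourMomentum m c p‖ = lorentzFactor m c p := by
  rw [WithLp.prod_norm_eq_of_L2, lorentzFactor, fourMomentum, WithLp.toLp_fst,
    WithLp.toLp_snd, norm_one, one_pow, norm_smul,
    mul_pow, norm_inv, inv_pow, Real.norm_eq_abs, sq_abs, div_eq_inv_mul]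

theorem one_le_norm_fourMomentum (m c : ℝ) (p : R3) : 1 ≤ ‖fourMomentum m c p‖ := by
  rw [norm_fourMomentum, lorentzFactor, Real.one_le_sqrt]
  exact le_add_of_nonneg_right (by positivity)

theorem norm_fourMomentum_sub (m c : ℝ) (p p' : R3) :
    ‖fourMomentum m c p - fourMomentum m c p'‖ = |m * c|⁻¹ * ‖p - p'‖ := by
  rw [fourMomentum, fourMomentum, ← WithLp.toLp_sub, Prod.mk_sub_mk, sub_self,
    WithLp.norm_toLp_snd, ← smul_sub, norm_smul, norm_inv, Real.norm_eq_abs]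

theorem velocity_eq_normalize (m : ℝ) (hc : c ≠ 0) (p : R3) :
    velocity m c p = c • (NormedSpace.normalize (fourMomentum m c p)).snd := by
  rw [velocity, NormedSpace.normalize, norm_fourMomentum, WithLp.smul_snd, fourMomentum,
    WithLp.toLp_snd, smul_smul, smul_smul]
  congr 1
  rw [mul_inv, mul_inv]
  field_simp

theorem isBoundedLipschitz_velocity (m : ℝ) (hc : c ≠ 0) : IsBoundedLipschitz (velocity m c) := by
  have hne (p : R3) : fourMomentum m c p ≠ 0 :=
    norm_pos_iff.1 (one_pos.trans_le (one_le_norm_fourMomentum m c p))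
  have hnormalize : IsBoundedLipschitz fun p => NormedSpace.normalize (fourMomentum m c p) := by
    refine .of_norm_le (fun p => (NormedSpace.norm_normalize_eq_one_iff.2 (hne p)).le)
      (K := 2 * |m * c|⁻¹) fun p p' => ?_
    rw [mul_assoc, dist_eq_norm, ← norm_fourMomentum_sub]
    exact norm_normalize_sub_le (one_le_norm_fourMomentum m c p) (hne p')
  rw [funext (velocity_eq_normalize m hc)]
  exact (hnormalize.clm (WithLp.sndL 2 ℝ ℝ R3)).const_smul c

theorem isBoundedLipschitz_beta (m : ℝ) (hc : c ≠ 0) : IsBoundedLipschitz (beta m c) :=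
  (isBoundedLipschitz_velocity m hc).const_smul c⁻¹

end Velocity

section LorentzForce

theorem cross_apply_eq (a b : R3) : cross a b =
    !₂[a 1 * b 2 - a 2 * b 1, a 2 * b 0 - a 0 * b 2, a 0 * b 1 - a 1 * b 0] := by
  rw [cross, cross_apply]

theorem norm_cross_le (a b : R3) : ‖cross a b‖ ≤ ‖a‖ * ‖b‖ := by
  have lagrange : ‖cross a b‖ ^ 2 + inner ℝ a b ^ 2 = (‖a‖ * ‖b‖) ^ 2 := by
    rw [mul_pow, cross_apply_eq]
    simp only [EuclideanSpace.real_norm_sq_eq, PiLp.inner_apply, Fin.sum_univ_three]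
    simp
    ring
  exact le_of_sq_le_sq (by linarith [sq_nonneg (inner ℝ a b)]) (by positivity)

/-- The cross product as a continuous bilinear map. -/
def crossL : R3 →L[ℝ] R3 →L[ℝ] R3 :=
  LinearMap.mkContinuous₂
    (LinearMap.mk₂ ℝ cross
      (fun a a' b => by ext i; fin_cases i <;> simp [cross_apply_eq] <;> ring)
      (fun t a b => by ext i; fin_cases i <;> simp [cross_apply_eq] <;> ring)
      (fun a b b' => by ext i; fin_cases i <;> simp [cross_apply_eq] <;> ring)
      (fun t a b => by ext i; fin_cases i <;> simp [cross_apply_eq] <;> ring))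
    1 fun a b => by simpa using norm_cross_le a b

theorem crossL_apply (a b : R3) : crossL a b = cross a b := rfl

theorem cross_anticomm (a b : R3) : cross a b = -cross b a := by
  ext i
  fin_cases i <;> simp [cross_apply_eq] <;> ring

variable {Ω : Set R3} {m c : ℝ}

theorem exists_vol_closedBall_le (Ω : Set R3) (R : ℝ) :
    ∃ M : NNReal, ∀ r, vol Ω (Metric.closedBall r R) ≤ M := by
  refine ⟨(volume (Metric.closedBall (0 : R3) R)).toNNReal, fun r => ?_⟩
  rw [ENNReal.coe_toNNReal measure_closedBall_lt_top.ne,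
    ← Measure.addHaar_closedBall_center volume r]
  exact Measure.restrict_le_self _

theorem SmearedDelta.isBoundedLipschitz (D : SmearedDelta) : IsBoundedLipschitz D.φ :=
  .of_contDiff (D.contDiff.of_le one_le_two) D.hasCompactSupport

theorem SmearedDelta.isBoundedLipschitz_gradient (D : SmearedDelta) :
    IsBoundedLipschitz (gradient D.φ) :=
  .of_contDiff ((InnerProductSpace.toDual ℝ R3).symm.contDiff.comp
    (D.contDiff.fderiv_right (m := 1) (by norm_num)))
    (hasCompactSupport_gradient D.hasCompactSupport)

theorem isBoundedLipschitz_current (Ω : Set R3) (D : SmearedDelta) (q m : ℝ) (hc : c ≠ 0) :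
    IsBoundedLipschitz fun θ : R3 × R3 => current Ω D q m c θ.1 θ.2 := by
  obtain ⟨κ, hκ, hκL⟩ := exists_translates (exists_vol_closedBall_le Ω) D.isBoundedLipschitz
    D.hasCompactSupport
  let ι : X Ω →L[ℝ] XX Ω := -q •
    ((WithLp.prodContinuousLinearEquiv 2 ℝ (X Ω) (X Ω)).symm : X Ω × X Ω →L[ℝ] XX Ω) ∘L
      ContinuousLinearMap.inl ℝ (X Ω) (X Ω)
  let B : Lp ℝ 2 (vol Ω) →L[ℝ] R3 →L[ℝ] X Ω :=
    ((ContinuousLinearMap.lsmul ℝ ℝ).flip.compLpL₂ 2 (vol Ω)).flip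
  have heq (r p : R3) : current Ω D q m c r p = ι (B (κ r) (velocity m c p)) := by
    have hE : (D.memLp Ω (-q) r (velocity m c p)).toLp = -q • B (κ r) (velocity m c p) := by
      ext1
      filter_upwards [MemLp.coeFn_toLp (D.memLp Ω (-q) r (velocity m c p)), hκ r,
        Lp.coeFn_smul (-q) (B (κ r) (velocity m c p)),
        ((ContinuousLinearMap.lsmul ℝ ℝ).flip (velocity m c p)).coeFn_compLp (κ r)]
        with x hcurrent hx hsmul hB
      rw [hcurrent, hsmul, Pi.smul_apply, mul_smul, ← hx]
      exact congrArg _ hB.symm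
    rw [current, hE]
    exact WithLp.ofLp_injective 2 (Prod.ext rfl (smul_zero _).symm)
  simp_rw [heq]
  exact ((hκL.comp LipschitzWith.prod_fst).bilin B
    ((isBoundedLipschitz_velocity m hc).comp LipschitzWith.prod_snd)).clm ι

theorem exists_smul_outwardNormal (Ω : Set R3) :
    ∃ L : L2Γ Ω →L[ℝ] Lp R3 2 (surf Ω), ∀ u, L u =ᵐ[surf Ω] fun x => u x • outwardNormal Ω x := by
  have hmem : MemLp (outwardNormal Ω) ⊤ (surf Ω) :=
    memLp_top_of_bound (measurable_outwardNormal Ω).aestronglyMeasurable 1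
      (.of_forall (norm_outwardNormal_le Ω))
  refine ⟨((ContinuousLinearMap.lsmul ℝ ℝ).holderL (surf Ω) 2 ⊤ 2).flip hmem.toLp, fun u => ?_⟩
  filter_upwards [(ContinuousLinearMap.lsmul ℝ ℝ).coeFn_holder (r := 2) u hmem.toLp,
    hmem.coeFn_toLp] with x hx hn
  exact hx.trans (congrArg _ hn)

theorem exists_smeared_fields (Ω : Set R3) (D : SmearedDelta) :
    ∃ K : R3 → X Ω →L[ℝ] R3, IsBoundedLipschitz K ∧ ∀ r b (E B : X Ω),
      ∫ x, D.φ (x - r) • (E x + cross b (B x)) ∂(vol Ω) = K r E + cross b (K r B) := by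
  obtain ⟨K, hK, hKeq⟩ := exists_integral_translate (exists_vol_closedBall_le Ω)
    D.isBoundedLipschitz D.hasCompactSupport (.lsmul ℝ ℝ : ℝ →L[ℝ] R3 →L[ℝ] R3)
  refine ⟨K, hK, fun r b E B => ?_⟩
  obtain ⟨hE, hKE⟩ := hKeq r E
  obtain ⟨hB, hKB⟩ := hKeq r B
  rw [hKE, hKB, ← crossL_apply, ← (crossL b).integral_comp_comm hB,
    ← integral_add hE ((crossL b).integrable_comp hB)]
  simp only [smul_add, ContinuousLinearMap.lsmul_apply, map_smul, crossL_apply]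

theorem exists_smeared_potential (Ω : Set R3) (D : SmearedDelta) :
    ∃ N : R3 → L2 Ω →L[ℝ] R3, IsBoundedLipschitz N ∧ ∀ r b (η : L2 Ω),
      ∫ x, η x • cross (gradient D.φ (x - r)) b ∂(vol Ω) = -cross b (N r η) := by
  obtain ⟨N, hN, hNeq⟩ := exists_integral_translate (exists_vol_closedBall_le Ω)
    D.isBoundedLipschitz_gradient (hasCompactSupport_gradient D.hasCompactSupport)
    (ContinuousLinearMap.lsmul ℝ ℝ : ℝ →L[ℝ] R3 →L[ℝ] R3).flip
  refine ⟨N, hN, fun r b η => ?_⟩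
  obtain ⟨hint, hNη⟩ := hNeq r η
  rw [hNη, ← crossL_apply, ← (crossL b).integral_comp_comm hint, ← integral_neg]
  simp only [cross_anticomm _ b, smul_neg, ContinuousLinearMap.flip_apply,
    ContinuousLinearMap.lsmul_apply, map_smul, crossL_apply]

theorem exists_smeared_boundaryValues (Ω : Set R3) [IsFiniteMeasure (surf Ω)]
    (D : SmearedDelta) :
    ∃ S : R3 → L2Γ Ω →L[ℝ] R3, IsBoundedLipschitz S ∧ ∀ r b (u : L2Γ Ω),
      ∫ x, (u x * D.φ (x - r)) • cross b (outwardNormal Ω x) ∂(surf Ω) = cross b (S r u) := by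
  have hball (R : ℝ) : ∃ M : NNReal, ∀ r, surf Ω (Metric.closedBall r R) ≤ M :=
    ⟨measureUnivNNReal (surf Ω), fun r => by
      rw [coe_measureUnivNNReal]
      exact measure_mono (subset_univ _)⟩
  obtain ⟨K, hK, hKeq⟩ := exists_integral_translate hball D.isBoundedLipschitz
    D.hasCompactSupport (.lsmul ℝ ℝ : ℝ →L[ℝ] R3 →L[ℝ] R3)
  obtain ⟨L, hL⟩ := exists_smul_outwardNormal Ω
  refine ⟨fun r => K r ∘L L, hK.clm_comp (isBoundedLipschitz_const _), fun r b u => ?_⟩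
  obtain ⟨hint, hKu⟩ := hKeq r (L u)
  rw [ContinuousLinearMap.comp_apply, hKu, ← crossL_apply, ← (crossL b).integral_comp_comm hint]
  refine integral_congr_ae ?_
  filter_upwards [hL u] with x hx
  rw [hx, ContinuousLinearMap.lsmul_apply, smul_smul, map_smul, crossL_apply, mul_comm]

theorem exists_force_eq_clm [IsFiniteMeasure (surf Ω)] (D : SmearedDelta) (q m : ℝ) (hc : c ≠ 0) :
    ∃ 𝓕 : R3 × R3 → (XX Ω × L2 Ω × L2Γ Ω →L[ℝ] R3), IsBoundedLipschitz 𝓕 ∧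
      ∀ u η V θ, force Ω D q m c u η V θ.1 θ.2 = 𝓕 θ (V, η, u) := by
  obtain ⟨K, hK, hfields⟩ := exists_smeared_fields Ω D
  obtain ⟨N, hN, hpotential⟩ := exists_smeared_potential Ω D
  obtain ⟨S, hS, hboundary⟩ := exists_smeared_boundaryValues Ω D
  let πE : XX Ω × L2 Ω × L2Γ Ω →L[ℝ] X Ω := WithLp.fstL 2 ℝ (X Ω) (X Ω) ∘L .fst ..
  let πB : XX Ω × L2 Ω × L2Γ Ω →L[ℝ] X Ω := WithLp.sndL 2 ℝ (X Ω) (X Ω) ∘L .fst ..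
  let πη : XX Ω × L2 Ω × L2Γ Ω →L[ℝ] L2 Ω := .fst .. ∘L .snd ..
  let πu : XX Ω × L2 Ω × L2Γ Ω →L[ℝ] L2Γ Ω := .snd .. ∘L .snd ..
  have hcomp {F : Type} [NormedAddCommGroup F] [NormedSpace ℝ F] {M : R3 → F →L[ℝ] R3}
      (hM : IsBoundedLipschitz M) (π : XX Ω × L2 Ω × L2Γ Ω →L[ℝ] F) :
      IsBoundedLipschitz fun θ : R3 × R3 => M θ.1 ∘L π :=
    (hM.comp LipschitzWith.prod_fst).clm_comp (isBoundedLipschitz_const π)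
  have hβ : IsBoundedLipschitz fun θ : R3 × R3 => crossL (beta m c θ.2) :=
    ((isBoundedLipschitz_beta m hc).clm crossL).comp LipschitzWith.prod_snd
  -- The potential and the boundary values enter the force like a magnetic field.
  refine ⟨fun θ => q • (K θ.1 ∘L πE +
      crossL (beta m c θ.2) ∘L (K θ.1 ∘L πB + (N θ.1 ∘L πη + S θ.1 ∘L πu))),
    ((hcomp hK πE).add (hβ.clm_comp ((hcomp hK πB).add
      ((hcomp hN πη).add (hcomp hS πu))))).const_smul q, fun u η V θ => ?_⟩
  rw [force, hfields, hpotential, hboundary, ← smul_sub, ← smul_add]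
  simp only [← crossL_apply, smul_apply, ContinuousLinearMap.comp_apply, add_apply, map_add]
  congr 1
  change K θ.1 V.fst + crossL _ (K θ.1 V.snd) - -crossL _ (N θ.1 η) + crossL _ (S θ.1 u) =
    K θ.1 V.fst + (crossL _ (K θ.1 V.snd) + (crossL _ (N θ.1 η) + crossL _ (S θ.1 u)))
  abel

end LorentzForce

/-! ### The reduced state system -/

section Duhamel

variable {H : Type} [NormedAddCommGroup H] [InnerProductSpace ℝ H] [CompleteSpace H]
  {A : H →ₗ.[ℝ] H} {P : Type*} [NormedAddCommGroup P] {T : ℝ}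

/-- Duhamel's formula for the mild solution of `V' + A V = j`, `V(0) = V₀`. -/
def IsMAccretive.duhamel (hA : IsMAccretive A) (V₀ : H) (j : ℝ → H) (t : ℝ) : H :=
  hA.semigroup t V₀ + ∫ τ in (0 : ℝ)..t, hA.semigroup (t - τ) (j τ)

theorem IsMAccretive.continuous_duhamel (hA : IsMAccretive A) (V₀ : H) {j : ℝ → H}
    (hj : Continuous j) : Continuous (hA.duhamel V₀ j) := by
  have hpair : Continuous fun p : ℝ × ℝ => (p.1 - p.2, j p.2) := by fun_prop
  refine (hA.continuous_semigroup V₀).add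
    (intervalIntegral.continuous_parametric_intervalIntegral_of_continuous ?_ continuous_id)
  simpa only [Function.comp_def, Function.uncurry_def] using
    hA.continuous_uncurry_semigroup.comp hpair

theorem IsMAccretive.eqOn_duhamel (hA : IsMAccretive A) (V₀ : H) {j j' : ℝ → H}
    (h : EqOn j j' (Icc 0 T)) : EqOn (hA.duhamel V₀ j) (hA.duhamel V₀ j') (Icc 0 T) :=
  fun t ht => congrArg (hA.semigroup t V₀ + ·) (intervalIntegral.integral_congr fun τ hτ => by
    rw [uIcc_of_le ht.1] at hτ
    exact congrArg (hA.semigroup (t - τ)) (h ⟨hτ.1, hτ.2.trans ht.2⟩))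

theorem IsMAccretive.continuousOn_duhamel (hA : IsMAccretive A) (V₀ : H) {j : ℝ → H}
    (hj : ContinuousOn j (Icc 0 T)) : ContinuousOn (hA.duhamel V₀ j) (Icc 0 T) := by
  rcases lt_or_ge T 0 with hT | hT
  · simp [Icc_eq_empty_of_lt hT]
  have hext : EqOn j (IccExtend hT ((Icc 0 T).domRestrict j)) (Icc 0 T) := fun t ht => by
    rw [IccExtend_of_mem hT _ ht]
    rfl
  exact (hA.continuous_duhamel V₀ hj.domRestrict.Icc_extend').continuousOn.congr
    (hA.eqOn_duhamel V₀ hext)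

theorem IsMAccretive.norm_duhamel_le (hA : IsMAccretive A) (V₀ : H) {j : ℝ → H} {J : ℝ}
    (hJ : ∀ t, ‖j t‖ ≤ J) {t : ℝ} (ht : t ∈ Icc 0 T) :
    ‖hA.duhamel V₀ j t‖ ≤ ‖V₀‖ + J * T := by
  have hJ0 : 0 ≤ J := (norm_nonneg _).trans (hJ 0)
  refine norm_add_le_of_le (hA.norm_semigroup_apply_le _ _)
    ((intervalIntegral.norm_integral_le_of_norm_le_const
      fun τ _ => (hA.norm_semigroup_apply_le _ _).trans (hJ τ)).trans ?_)
  rw [sub_zero, abs_of_nonneg ht.1]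
  exact mul_le_mul_of_nonneg_left ht.2 hJ0

theorem IsMAccretive.norm_duhamel_sub_le (hA : IsMAccretive A) (V₀ : H) {j j' : ℝ → H}
    (hj : ContinuousOn j (Icc 0 T)) (hj' : ContinuousOn j' (Icc 0 T)) {d t : ℝ} (ht : t ∈ Icc 0 T)
    (hd : ∀ τ ∈ Icc 0 t, ‖j τ - j' τ‖ ≤ d) :
    ‖hA.duhamel V₀ j t - hA.duhamel V₀ j' t‖ ≤ d * T := by
  have hd0 : 0 ≤ d := (norm_nonneg _).trans (hd 0 ⟨le_rfl, ht.1⟩)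
  have hint {j : ℝ → H} (hj : ContinuousOn j (Icc 0 T)) :
      IntervalIntegrable (fun τ => hA.semigroup (t - τ) (j τ)) volume 0 t := by
    have hpair : ContinuousOn (fun τ => (t - τ, j τ)) (uIcc 0 t) := by
      rw [uIcc_of_le ht.1]
      exact ContinuousOn.prodMk (by fun_prop) (hj.mono (Icc_subset_Icc_right ht.2))
    exact (hA.continuous_uncurry_semigroup.comp_continuousOn hpair).intervalIntegrable
  rw [duhamel, duhamel, add_sub_add_left_eq_sub,
    ← intervalIntegral.integral_sub (hint hj) (hint hj')]
  refine (intervalIntegral.norm_integral_le_of_norm_le_const (C := d) fun τ hτ => ?_).trans ?_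
  · rw [uIoc_of_le ht.1] at hτ
    rw [← map_sub]
    exact (hA.norm_semigroup_apply_le _ _).trans (hd τ ⟨hτ.1.le, hτ.2⟩)
  · rw [sub_zero, abs_of_nonneg ht.1]
    exact mul_le_mul_of_nonneg_left ht.2 hd0

theorem IsMAccretive.exists_isCausal_duhamel (hA : IsMAccretive A) (V₀ : H) {j : P → H}
    (hj : IsBoundedLipschitz j) {F : P → H → P}
    (hF : ∀ R, ∃ K, LipschitzOnWith K (fun z : P × H => F z.1 z.2)
      (univ ×ˢ Metric.closedBall 0 R)) :
    ∃ L, IsCausal T L fun y t => F (y t) (hA.duhamel V₀ (fun τ => j (y τ)) t) := by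
  obtain ⟨J, hJ, hjJ, hjL⟩ := hj.exists_bound
  obtain ⟨K, hK⟩ := hF (‖V₀‖ + J * T)
  have hFc : Continuous fun z : P × H => F z.1 z.2 := by
    refine continuous_iff_continuousAt.2 fun z => ?_
    obtain ⟨K, hK⟩ := hF (‖z.2‖ + 1)
    exact hK.continuousOn.continuousAt (prod_mem_nhds univ_mem
      (Metric.closedBall_mem_nhds_of_mem (mem_ball_zero_iff.2 (lt_add_one _))))
  refine ⟨K * max 1 (J * T), by positivity, fun y hy => ?_, fun y y' hy hy' t ht b hb => ?_⟩
  · exact hFc.comp (hy.prodMk (hA.continuous_duhamel V₀ (hj.continuous.comp hy)))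
  · have hb0 : 0 ≤ b := (norm_nonneg _).trans (hb 0 ⟨le_rfl, ht.1⟩)
    have hV (y : ℝ → P) : hA.duhamel V₀ (fun τ => j (y τ)) t ∈
        Metric.closedBall 0 (‖V₀‖ + J * T) :=
      mem_closedBall_zero_iff.2 (hA.norm_duhamel_le V₀ (fun τ => hjJ (y τ)) ht)
    have hdiff : ‖hA.duhamel V₀ (fun τ => j (y τ)) t - hA.duhamel V₀ (fun τ => j (y' τ)) t‖ ≤
        J * b * T :=
      hA.norm_duhamel_sub_le V₀ (hj.continuous.comp_continuousOn hy)
        (hj.continuous.comp_continuousOn hy') ht fun τ hτ =>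
        (hjL _ _).trans (by rw [dist_eq_norm]; gcongr; exact hb τ hτ)
    have hlip := hK.norm_sub_le (x := (y t, _)) (y := (y' t, _)) ⟨mem_univ _, hV y⟩
      ⟨mem_univ _, hV y'⟩
    refine hlip.trans ?_
    rw [mul_assoc, Prod.mk_sub_mk]
    gcongr
    refine norm_prod_le_iff.2 ⟨(hb t ⟨ht.1, le_rfl⟩).trans ?_, hdiff.trans ?_⟩
    · exact le_mul_of_one_le_left hb0 (le_max_left _ _)
    · rw [mul_right_comm]
      gcongr
      exact le_max_right _ _

end Duhamel

section ReducedSystem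

variable {Ω : Set R3} {T : ℝ}

theorem isMildSolution_iff (hΩ : IsOpen Ω) {V₀ : XX Ω} {j V : ℝ → XX Ω}
    (hj : ContinuousOn j (Icc 0 T)) :
    IsMildSolution Ω T V₀ j V ↔
      EqOn V ((isMAccretive_maxwell hΩ).duhamel V₀ j) (Icc 0 T) := by
  refine ⟨fun ⟨_, G, hG, hV⟩ t ht => ?_, fun h =>
    ⟨((isMAccretive_maxwell hΩ).continuousOn_duhamel V₀ hj).congr h, _,
      isMaxwellSemigroup_semigroup hΩ, h⟩⟩
  rw [hV t ht, IsMAccretive.duhamel, hG.eq_semigroup hΩ ht.1]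
  congr 1
  refine intervalIntegral.integral_congr fun τ hτ => ?_
  rw [uIcc_of_le ht.1] at hτ
  exact DFunLike.congr_fun (hG.eq_semigroup hΩ (sub_nonneg.2 hτ.2)) (j τ)

variable (hΩ : IsOpen Ω) (D : SmearedDelta) (q m c : ℝ) (r₀ p₀ : R3) (V₀ : XX Ω)

/-- The electromagnetic fields generated by a particle with trajectory `y = (w, z)`. -/
def fields (y : ℝ → R3 × R3) : ℝ → XX Ω :=
  (isMAccretive_maxwell hΩ).duhamel V₀ fun t => current Ω D q m c ((y t).1 + r₀) ((y t).2 + p₀)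

/-- The right-hand side of the reduced state system `y' = stateRhs y` for `y = (w, z)`, with the
fields eliminated by Duhamel's formula. -/
def stateRhs (u : L2Γ Ω) (η : L2 Ω) (y : ℝ → R3 × R3) (t : ℝ) : R3 × R3 :=
  (velocity m c ((y t).2 + p₀),
    force Ω D q m c u η (fields hΩ D q m c r₀ p₀ V₀ y t) ((y t).1 + r₀) ((y t).2 + p₀))

theorem lipschitzWith_shift (a b : R3) :
    LipschitzWith 1 fun θ : R3 × R3 => (θ.1 + a, θ.2 + b) := by
  refine .of_dist_le_mul fun θ θ' => ?_
  simp only [Prod.dist_eq, dist_add_right, NNReal.coe_one, one_mul, le_refl]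

variable {c}

theorem isBoundedLipschitz_shifted_current (hc : c ≠ 0) :
    IsBoundedLipschitz fun θ : R3 × R3 => current Ω D q m c (θ.1 + r₀) (θ.2 + p₀) := by
  simpa only [Function.comp_def] using
    (isBoundedLipschitz_current Ω D q m hc).comp (lipschitzWith_shift r₀ p₀)

theorem isBoundedLipschitz_shifted_velocity (hc : c ≠ 0) :
    IsBoundedLipschitz fun θ : R3 × R3 => velocity m c (θ.2 + p₀) := by
  simpa only [Function.comp_def] using (isBoundedLipschitz_velocity m hc).comp
    (LipschitzWith.prod_snd.comp (lipschitzWith_shift 0 p₀))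

theorem exists_shifted_force_eq_clm [IsFiniteMeasure (surf Ω)] (hc : c ≠ 0) :
    ∃ 𝓕 : R3 × R3 → (XX Ω × L2 Ω × L2Γ Ω →L[ℝ] R3), IsBoundedLipschitz 𝓕 ∧
      ∀ u η V θ, force Ω D q m c u η V (θ.1 + r₀) (θ.2 + p₀) = 𝓕 θ (V, η, u) := by
  obtain ⟨𝓕, h𝓕, hforce⟩ := exists_force_eq_clm (Ω := Ω) D q m hc
  exact ⟨_, h𝓕.comp (lipschitzWith_shift r₀ p₀), fun u η V θ =>
    hforce u η V (θ.1 + r₀, θ.2 + p₀)⟩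

theorem exists_isCausal_stateRhs [IsFiniteMeasure (surf Ω)] (hc : c ≠ 0) (u : L2Γ Ω)
    (η : L2 Ω) : ∃ L, IsCausal T L (stateRhs hΩ D q m c r₀ p₀ V₀ u η) := by
  obtain ⟨𝓕, h𝓕, hforce⟩ := exists_shifted_force_eq_clm (Ω := Ω) D q m r₀ p₀ hc
  obtain ⟨K, hK⟩ := (isBoundedLipschitz_shifted_velocity m p₀ hc).lipschitz
  have hlip (R : ℝ) : ∃ K, LipschitzOnWith K (fun z : (R3 × R3) × XX Ω =>
      (velocity m c (z.1.2 + p₀), 𝓕 z.1 (z.2, η, u))) (univ ×ˢ Metric.closedBall 0 R) := by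
    obtain ⟨K', hK'⟩ := h𝓕.exists_lipschitzOnWith_apply_prodMk R (η, u)
    exact ⟨_, (hK.comp LipschitzWith.prod_fst).lipschitzOnWith.prodMk hK'⟩
  have hcausal := (isMAccretive_maxwell hΩ).exists_isCausal_duhamel (T := T) V₀
    (isBoundedLipschitz_shifted_current D q m r₀ p₀ hc)
    (F := fun θ V => (velocity m c (θ.2 + p₀), 𝓕 θ (V, η, u))) hlip
  simp only [← hforce] at hcausal
  exact hcausal

theorem exists_norm_stateRhs_le [IsFiniteMeasure (surf Ω)] (hT : 0 ≤ T) (hc : c ≠ 0) :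
    ∃ K, 0 ≤ K ∧ ∀ u η y, ∀ t ∈ Icc 0 T,
      ‖stateRhs hΩ D q m c r₀ p₀ V₀ u η y t‖ ≤ K * (1 + ‖η‖ + ‖u‖) := by
  obtain ⟨C, hC, hvelocity, -⟩ := (isBoundedLipschitz_shifted_velocity m p₀ hc).exists_bound
  obtain ⟨J, hJ, hcurrent, -⟩ :=
    (isBoundedLipschitz_shifted_current (Ω := Ω) D q m r₀ p₀ hc).exists_bound
  obtain ⟨𝓕, h𝓕, hforce⟩ := exists_shifted_force_eq_clm (Ω := Ω) D q m r₀ p₀ hc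
  obtain ⟨A, hA, h𝓕A, -⟩ := h𝓕.exists_bound
  set Q := ‖V₀‖ + J * T
  have hQ : 0 ≤ Q := by positivity
  refine ⟨C + A * (Q + 1), by positivity, fun u η y t ht => norm_prod_le_iff.2 ⟨?_, ?_⟩⟩
  · calc ‖velocity m c ((y t).2 + p₀)‖ ≤ C := hvelocity (y t)
      _ ≤ C + A * (Q + 1) := le_add_of_nonneg_right (by positivity)
      _ ≤ (C + A * (Q + 1)) * (1 + ‖η‖ + ‖u‖) :=
        le_mul_of_one_le_right (by positivity) (by linarith [norm_nonneg η, norm_nonneg u])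
  · have hfields : ‖fields hΩ D q m c r₀ p₀ V₀ y t‖ ≤ Q :=
      (isMAccretive_maxwell hΩ).norm_duhamel_le V₀ (fun τ => hcurrent (y τ)) ht
    have hforcing : ‖(fields hΩ D q m c r₀ p₀ V₀ y t, η, u)‖ ≤ Q + ‖η‖ + ‖u‖ :=
      norm_prod_le_iff.2 ⟨by linarith [norm_nonneg η, norm_nonneg u],
        norm_prod_le_iff.2 ⟨by linarith [norm_nonneg u], by linarith [norm_nonneg η]⟩⟩
    calc ‖force Ω D q m c u η _ ((y t).1 + r₀) ((y t).2 + p₀)‖ ≤ A * (Q + ‖η‖ + ‖u‖) := by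
          rw [hforce]
          exact ContinuousLinearMap.le_of_opNorm_le_of_le _ (h𝓕A _) hforcing
      _ ≤ A * ((Q + 1) * (1 + ‖η‖ + ‖u‖)) := by
          gcongr
          nlinarith [mul_nonneg hQ (norm_nonneg η), mul_nonneg hQ (norm_nonneg u)]
      _ ≤ (C + A * (Q + 1)) * (1 + ‖η‖ + ‖u‖) := by
          rw [← mul_assoc]
          exact mul_le_mul_of_nonneg_right (le_add_of_nonneg_left hC) (by positivity)

theorem derivWithin_prodMk_Icc {E F : Type*} [NormedAddCommGroup E] [NormedSpace ℝ E]
    [NormedAddCommGroup F] [NormedSpace ℝ F] (hT : 0 < T) {w : ℝ → E} {z : ℝ → F}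
    (hw : ContDiffOn ℝ 1 w (Icc 0 T)) (hz : ContDiffOn ℝ 1 z (Icc 0 T)) {t : ℝ}
    (ht : t ∈ Icc 0 T) :
    derivWithin (fun t => (w t, z t)) (Icc 0 T) t =
      (derivWithin w (Icc 0 T) t, derivWithin z (Icc 0 T) t) :=
  ((hw.differentiableOn one_ne_zero t ht).hasDerivWithinAt.prodMk
    (hz.differentiableOn one_ne_zero t ht).hasDerivWithinAt).derivWithin
      (uniqueDiffOn_Icc hT t ht)

theorem isReducedSolution_iff (hT : 0 < T) (hc : c ≠ 0) {E₀ B₀ : X Ω} {u : L2Γ Ω} {η : L2 Ω}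
    (hη : ∀ η', IsVeryWeakSolution Ω u η' ↔ η' = η) {w z : ℝ → R3} :
    IsReducedSolution Ω T D q m c r₀ p₀ E₀ B₀ u w z ↔
      IsVolterraSolution T (stateRhs hΩ D q m c r₀ p₀ (WithLp.toLp 2 (E₀, B₀)) u η)
        fun t => (w t, z t) := by
  have hj (hw : ContDiffOn ℝ 1 w (Icc 0 T)) (hz : ContDiffOn ℝ 1 z (Icc 0 T)) :
      ContinuousOn (fun t => current Ω D q m c (w t + r₀) (z t + p₀)) (Icc 0 T) := by
    simpa only [Function.comp_def] using
      (isBoundedLipschitz_shifted_current D q m r₀ p₀ hc).continuous.comp_continuousOn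
        (hw.continuousOn.prodMk hz.continuousOn)
  constructor
  · rintro ⟨⟨hw, hw0⟩, ⟨hz, hz0⟩, V, η', hV, hη', hderiv⟩
    obtain rfl := (hη η').1 hη'
    refine ⟨hw.prodMk hz, Prod.ext hw0 hz0, fun t ht => ?_⟩
    have hVt : V t = fields hΩ D q m c r₀ p₀ _ (fun t => (w t, z t)) t :=
      (isMildSolution_iff hΩ (hj hw hz)).1 hV ht
    rw [derivWithin_prodMk_Icc hT hw hz ht, (hderiv t ht).1, (hderiv t ht).2, hVt]
    rfl
  · rintro ⟨hwz, h0, hderiv⟩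
    refine ⟨⟨hwz.fst, congrArg Prod.fst h0⟩, ⟨hwz.snd, congrArg Prod.snd h0⟩, _, η,
      (isMildSolution_iff hΩ (hj hwz.fst hwz.snd)).2 fun _ _ => rfl, (hη η).2 rfl,
      fun t ht => ?_⟩
    have h := (derivWithin_prodMk_Icc hT hwz.fst hwz.snd ht).symm.trans (hderiv ht)
    exact ⟨congrArg Prod.snd h, congrArg Prod.fst h⟩

theorem norm_toLp_prod_le (a b : R3) :
    ‖(WithLp.toLp 2 (a, b) : WithLp 2 (R3 × R3))‖ ≤ 2 * ‖(a, b)‖ := by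
  have hsplit : (WithLp.toLp 2 (a, b) : WithLp 2 (R3 × R3)) =
      WithLp.toLp 2 (a, 0) + WithLp.toLp 2 (0, b) := by
    rw [← WithLp.toLp_add, Prod.mk_add_mk, add_zero, zero_add]
  rw [hsplit, two_mul]
  refine norm_add_le_of_le ?_ ?_
  · rw [WithLp.norm_toLp_fst]
    exact le_max_left _ _
  · rw [WithLp.norm_toLp_snd]
    exact le_max_right _ _

theorem IsVolterraSolution.c1Norm_le {Φ : (ℝ → R3 × R3) → ℝ → R3 × R3} (hT : 0 < T)
    {w z : ℝ → R3} (h : IsVolterraSolution T Φ fun t => (w t, z t)) {M : ℝ}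
    (hM : ∀ t ∈ Icc 0 T, ‖Φ (fun t => (w t, z t)) t‖ ≤ M) :
    c1Norm T w z ≤ (T + 1) * (2 * M) := by
  have h0 : (0 : ℝ) ∈ Icc 0 T := ⟨le_rfl, hT.le⟩
  have : Nonempty (Icc (0 : ℝ) T) := ⟨0, h0⟩
  have hM0 : 0 ≤ M := (norm_nonneg _).trans (hM 0 h0)
  have hderiv {t : ℝ} (ht : t ∈ Icc 0 T) :
      ‖derivWithin (fun t => (w t, z t)) (Icc 0 T) t‖ ≤ M := by
    rw [h.derivWithin_eq ht]
    exact hM t ht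
  have hvalue {t : ℝ} (ht : t ∈ Icc 0 T) : ‖(w t, z t)‖ ≤ M * T := by
    have hmean := (convex_Icc 0 T).norm_image_sub_le_of_norm_derivWithin_le
      (h.contDiffOn.differentiableOn one_ne_zero) (fun _ => hderiv) h0 ht
    rw [h.map_zero, sub_zero, sub_zero, Real.norm_of_nonneg ht.1] at hmean
    exact hmean.trans (mul_le_mul_of_nonneg_left ht.2 hM0)
  rw [add_mul, one_mul]
  refine add_le_add (ciSup_le fun ⟨t, ht⟩ => ?_) (ciSup_le fun ⟨t, ht⟩ => ?_)
  · calc _ ≤ 2 * ‖(w t, z t)‖ := norm_toLp_prod_le _ _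
      _ ≤ 2 * (M * T) := mul_le_mul_of_nonneg_left (hvalue ht) zero_le_two
      _ = T * (2 * M) := by ring
  · refine (norm_toLp_prod_le _ _).trans (mul_le_mul_of_nonneg_left ?_ zero_le_two)
    rw [← derivWithin_prodMk_Icc hT h.contDiffOn.fst h.contDiffOn.snd ht]
    exact hderiv ht

end ReducedSystem

end Abraham

end

theorem theorem4p1_general (Ω : Set Abraham.R3) (hopen : IsOpen Ω)
    (harea : Abraham.surf Ω Set.univ < ⊤) (hreg : Abraham.PoissonRegular Ω)
    (T : ℝ) (hT : 0 < T) (D : Abraham.SmearedDelta) (q m c : ℝ) (_hm : m ≠ 0) (hc : c ≠ 0)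
    (r₀ p₀ : Abraham.R3) (E₀ B₀ : Abraham.X Ω) :
    ∃ C₁ > 0, ∃ C₂ > 0, ∀ u : Abraham.L2Γ Ω,
      ∃ w z : ℝ → Abraham.R3,
        Abraham.IsReducedSolution Ω T D q m c r₀ p₀ E₀ B₀ u w z ∧
        (∀ w' z' : ℝ → Abraham.R3,
          Abraham.IsReducedSolution Ω T D q m c r₀ p₀ E₀ B₀ u w' z' →
            Set.EqOn w' w (Set.Icc 0 T) ∧ Set.EqOn z' z (Set.Icc 0 T)) ∧
        Abraham.c1Norm T w z ≤ C₁ * ‖u‖ + C₂ := by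
  have : IsFiniteMeasure (Abraham.surf Ω) := ⟨harea⟩
  let η := hreg.veryWeakSolution
  obtain ⟨K, hK, hbound⟩ :=
    Abraham.exists_norm_stateRhs_le hopen D q m r₀ p₀ (.toLp 2 (E₀, B₀)) hT.le hc
  refine ⟨(T + 1) * (2 * (K * (‖η‖ + 1))) + 1, by positivity, (T + 1) * (2 * K) + 1,
    by positivity, fun u => ?_⟩
  have hsol {w z : ℝ → Abraham.R3} :=
    Abraham.isReducedSolution_iff hopen D q m r₀ p₀ hT hc (E₀ := E₀) (B₀ := B₀) (w := w) (z := z)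
      fun _ => hreg.isVeryWeakSolution_iff (u := u) hopen
  obtain ⟨L, hcausal⟩ := Abraham.exists_isCausal_stateRhs (T := T) hopen D q m r₀ p₀
    (.toLp 2 (E₀, B₀)) hc u (η u)
  obtain ⟨y, hy⟩ := hcausal.exists_isVolterraSolution hT
  refine ⟨fun t => (y t).1, fun t => (y t).2, hsol.2 hy, fun w' z' h => ?_, ?_⟩
  · have heq := hcausal.eqOn_of_isVolterraSolution hT.le (hsol.1 h) hy
    exact ⟨fun t ht => congrArg Prod.fst (heq ht), fun t ht => congrArg Prod.snd (heq ht)⟩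
  · have hrhs : ∀ t ∈ Set.Icc 0 T, _ ≤ K * (1 + ‖η‖ * ‖u‖ + ‖u‖) := fun t ht =>
      (hbound u (η u) y t ht).trans (by gcongr; exact η.le_opNorm u)
    linarith [hy.c1Norm_le hT hrhs, norm_nonneg u]

theorem theorem4p1 (Ω : Set Abraham.R3) (hopen : IsOpen Ω) (hbdd : Bornology.IsBounded Ω)
    (hsc : IsSimplyConnected Ω) (harea : Abraham.surf Ω Set.univ < ⊤)
    (hreg : Abraham.PoissonRegular Ω)
    (T : ℝ) (hT : 0 < T) (D : Abraham.SmearedDelta)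
    (q m c : ℝ) (hq : 0 < q) (hm : 0 < m) (hc : 0 < c)
    (r₀ p₀ : Abraham.R3) (E₀ B₀ : Abraham.X Ω) :
    ∃ C₁ > 0, ∃ C₂ > 0, ∀ u : Abraham.L2Γ Ω,
      ∃ w z : ℝ → Abraham.R3,
        Abraham.IsReducedSolution Ω T D q m c r₀ p₀ E₀ B₀ u w z ∧
        (∀ w' z' : ℝ → Abraham.R3,
          Abraham.IsReducedSolution Ω T D q m c r₀ p₀ E₀ B₀ u w' z' →
            Set.EqOn w' w (Set.Icc 0 T) ∧ Set.EqOn z' z (Set.Icc 0 T)) ∧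
        Abraham.c1Norm T w z ≤ C₁ * ‖u‖ + C₂ :=
  theorem4p1_general Ω hopen harea hreg T hT D q m c hm.ne' hc.ne' r₀ p₀ E₀ B₀
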